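/- Let $\mathbb{E}_1^{n}$, $n=2k$, $k\ge 1$, be Minkowski space with $\mathbf{x}\cdot\mathbf{y}=-x_1y_1+x_2y_2+\dots+x_ny_n$. Let $\alpha:I\to\mathbb{E}_1^{2k}$ ($I$ a non-empty open interval) be a non-null curve of class $C^{2k}$ with pseudo-orthonormal Frenet frame $\mathbf{e}_1,\dots,\mathbf{e}_{2k}$, $\mathbf{e}_i\cdot\mathbf{e}_i=\varepsilon_i=\pm1$, and curvatures $\kappa_1>0,\ \kappa_2,\dots,\kappa_{2k-2}>0,\ \kappa_{2k-1}\ne0$, so that with respect to arc length $s$ $$\frac{d\mathbf{e}_i}{ds}=-\varepsilon_{i-1}\kappa_{i-1}\mathbf{e}_{i-1}+\varepsilon_{i+1}\kappa_i\mathbf{e}_{i+1}\qquad(\text{terms with index }0\text{ or }2k+1\text{ omitted}),$$ parametrized by a spherical arc-length parameter $\sigma$ (an arc-length parameter of $\mathbf{e}_1$, so $d\sigma=\kappa_1ds$). Suppose $\alpha$ is self-similar with non-zero invariants, in the sense that its p-shape curvatures $\tilde\kappa_1=-\frac1{\kappa_1}\frac{d\kappa_1}{d\sigma}$ and $\tilde\kappa_i=\kappa_i/\kappa_1$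 ($2\le i\le 2k-1$) are non-zero constants. Let $M$ be the constant tridiagonal matrix with $\frac{d}{d\sigma}\mathbf{e}_i=\sum_jM_{ij}\mathbf{e}_j$, that is, with $M_{i,i+1}=\varepsilon_{i+1}\kappa_i/\kappa_1$, $M_{i+1,i}=-\varepsilon_i\kappa_i/\kappa_1$ and all other entries $0$. Suppose that $\nu_1,\dots,\nu_k$ are pairwise different and are all the real eigenvalues of $M^2$, with $\nu_1$ the largest, and that $\tilde\kappa_1^2<\nu_1$. Suppose $\mathbf{e}_1$ is timelike (case i) or $\mathbf{e}_2$ is timelike (case ii). Then there are real numbers $\lambda_1>0$, $\lambda_2,\dots,\lambda_k\neq0$ with $$\nu_1=\lambda_1^2,\qquad \nu_i=-\lambda_i^2\quad(2\le i\le k),$$ non-zero real numbers $a_1,\dots,a_k$, a number $c>0$, a pseudo-orthogonal matrix $A$ and a vector $b$ such that the similar curve $\hat\alpha=cA\alpha+b$ is given for all $\sigma\in I$ by the formulas below. If the frame $(\mathbf{e}_1,\dots,\mathbf{e}_{2k})$ is positively oriented, then $\det A=1$. Put $$b_1=\sqrt{\lambda_1^2-\tilde\kappa_1^2},\quad \theta_1=\lambda_1\sigma-\cosh^{-1}\frac{\lambda_1}{b_1},\qquad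 b_i=\sqrt{\lambda_i^2+\tilde\kappa_1^2},\quad \theta_i=\lambda_i\sigma+\cos^{-1}\frac{\lambda_i}{b_i}\quad(2\le i\le k).$$ i) If $\mathbf{e}_1$ is timelike, then $$\hat\alpha(\sigma)=e^{\tilde\kappa_1\sigma}\Big(\tfrac{a_1}{b_1}\sinh\theta_1,\tfrac{a_1}{b_1}\cosh\theta_1,\tfrac{a_2}{b_2}\sin\theta_2,-\tfrac{a_2}{b_2}\cos\theta_2,\dots,\tfrac{a_k}{b_k}\sin\theta_k,-\tfrac{a_k}{b_k}\cos\theta_k\Big),$$ and $a_1,\dots,a_k$ solve the quadratic equations $\hat{\mathbf{e}}_1\cdot\hat{\mathbf{e}}_1=-1$, $\hat{\mathbf{e}}_i\cdot\hat{\mathbf{e}}_i=1$ ($2\le i\le k$). ii) If $\mathbf{e}_2$ is timelike, then $$\hat\alpha(\sigma)=e^{\tilde\kappa_1\sigma}\Big(-\tfrac{a_1}{b_1}\cosh\theta_1,-\tfrac{a_1}{b_1}\sinh\theta_1,\tfrac{a_2}{b_2}\sin\theta_2,-\tfrac{a_2}{b_2}\cos\theta_2,\dots,\tfrac{a_k}{b_k}\sin\theta_k,-\tfrac{a_k}{b_k}\cos\theta_k\Big),$$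 and $a_1,\dots,a_k$ solve the quadratic equations $\hat{\mathbf{e}}_2\cdot\hat{\mathbf{e}}_2=-1$, $\hat{\mathbf{e}}_i\cdot\hat{\mathbf{e}}_i=1$ ($1\le i\le k$, $i\ne2$). Here the vectors $\hat{\mathbf{e}}_i(\sigma)$ are computed from the right-hand side of the formula for $\hat\alpha$, taken for all $\sigma\in\mathbb{R}$, by $$\hat{\mathbf{e}}_1=e^{-\tilde\kappa_1\sigma}\frac{d\hat\alpha}{d\sigma},\quad \hat{\mathbf{e}}_2=\varepsilon_2\frac{d\hat{\mathbf{e}}_1}{d\sigma},\quad \hat{\mathbf{e}}_3=\frac{\varepsilon_3}{\tilde\kappa_2}\Big(\varepsilon_1\hat{\mathbf{e}}_1+\frac{d\hat{\mathbf{e}}_2}{d\sigma}\Big),\quad \hat{\mathbf{e}}_{i+1}=\frac{\varepsilon_{i+1}}{\tilde\kappa_i}\Big(\varepsilon_{i-1}\tilde\kappa_{i-1}\hat{\mathbf{e}}_{i-1}+\frac{d\hat{\mathbf{e}}_i}{d\sigma}\Big)\quad(i\ge3),$$ the equations hold for every $\sigma\in\mathbb{R}$, and $\hat{\mathbf{e}}_i=A\mathbf{e}_i$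 on $I$ for $1\le i\le 2k$. -/

import Mathlib

noncomputable section

/-! Minkowski space of dimension `n` is `Fin n → ℝ` with the Lorentzian inner product of signature
`(-, +, …, +)`.  Frames, curvatures and coefficients are indexed from `1`, by natural numbers. -/

/-- The matrix `diag(-1, 1, …, 1)`. -/
def minkMatrix (n : ℕ) : Matrix (Fin n) (Fin n) ℝ :=
  Matrix.diagonal fun i => if (i : ℕ) = 0 then -1 else 1

/-- The Lorentzian inner product `x · y = xᵀ diag(-1, 1, …, 1) y`. -/
def mink {n : ℕ} (x y : Fin n → ℝ) : ℝ :=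
  dotProduct x ((minkMatrix n).mulVec y)

/-- The Lorentzian norm `‖x‖ = √|x · x|`. -/
def minkNorm {n : ℕ} (x : Fin n → ℝ) : ℝ :=
  Real.sqrt |mink x x|

/-- Pseudo-orthogonal matrices, the linear isometries of Minkowski space. -/
def IsPseudoOrthogonal {n : ℕ} (A : Matrix (Fin n) (Fin n) ℝ) : Prop :=
  A.transpose * minkMatrix n * A = minkMatrix n

/-- `α` is a non-null regular curve of class `C^n` on `I`, in an arbitrary regular parameter, with
Frenet frame `e 1, …, e n`, causal signs `ε 1, …, ε n` (`-1` for timelike, `1` for spacelike) and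
curvatures `κ 1, …, κ (n - 1)`.  The Frenet equations are with respect to arc length `s`, where
`ds = ‖α'(t)‖ dt`. -/
structure IsFrenetCurve (n : ℕ) (I : Set ℝ) (α : ℝ → Fin n → ℝ)
    (e : ℕ → ℝ → Fin n → ℝ) (ε : ℕ → ℝ) (κ : ℕ → ℝ → ℝ) : Prop where
  contDiffOn : ContDiffOn ℝ n α I
  nonnull : ∀ t ∈ I, mink (deriv α t) (deriv α t) ≠ 0
  tangent : ∀ t ∈ I, deriv α t = minkNorm (deriv α t) • e 1 t
  sign : ∀ i ∈ Set.Icc 1 n, ε i = 1 ∨ ε i = -1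
  orthonormal : ∀ t ∈ I, ∀ i ∈ Set.Icc 1 n, ∀ j ∈ Set.Icc 1 n,
    mink (e i t) (e j t) = if i = j then ε i else 0
  frenet : ∀ t ∈ I, ∀ i ∈ Set.Icc 1 n, HasDerivAt (e i)
    (minkNorm (deriv α t) •
      ((if 1 < i then -(ε (i - 1) * κ (i - 1) t) • e (i - 1) t else 0) +
        (if i < n then (ε (i + 1) * κ i t) • e (i + 1) t else 0))) t
  curvature_one_pos : ∀ t ∈ I, 0 < κ 1 t
  curvature_pos : ∀ t ∈ I, ∀ j, 1 ≤ j → j + 2 ≤ n → 0 < κ j t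
  curvature_last_ne : ∀ t ∈ I, κ (n - 1) t ≠ 0

/-- The parameter is an arc length parameter of the tangent indicatrix `e₁`. -/
def IsSphericalArcLength {n : ℕ} (I : Set ℝ) (e : ℕ → ℝ → Fin n → ℝ) : Prop :=
  ∀ σ ∈ I, minkNorm (deriv (e 1) σ) = 1

/-- The p-shape curvatures `-(1/κ₁) dκ₁/dσ` (for `i = 1`) and `κᵢ/κ₁` (for `i ≥ 2`) of a curve in
a spherical arc length parameter `σ`. -/
def pShapeCurvature (κ : ℕ → ℝ → ℝ) (i : ℕ) (σ : ℝ) : ℝ :=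
  if i = 1 then -(1 / κ 1 σ) * deriv (κ 1) σ else κ i σ / κ 1 σ

/-- The ratios `κᵢ/κ₁` for all `i ≥ 1`, from the constant p-shape curvatures `kt`. -/
def curvRatio (kt : ℕ → ℝ) (i : ℕ) : ℝ :=
  if i = 1 then 1 else kt i

/-- The tridiagonal matrix `M` of the frame equations `d e_i / dσ = ∑ j, M i j e_j`.  Row `i` of
`Fin n` belongs to the frame vector with index `i + 1`. -/
def shapeMatrix (n : ℕ) (ε kt : ℕ → ℝ) : Matrix (Fin n) (Fin n) ℝ :=
  Matrix.of fun i j =>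
    if (j : ℕ) = i + 1 then ε (j + 1) * curvRatio kt (i + 1)
    else if (i : ℕ) = j + 1 then -(ε (j + 1) * curvRatio kt (j + 1))
    else 0

/-- `b₁ = √(λ₁² - κ̃₁²)` and `bᵢ = √(λᵢ² + κ̃₁²)` for `i ≥ 2`. -/
def bCoeff (kt₁ : ℝ) (lam : ℕ → ℝ) (i : ℕ) : ℝ :=
  if i = 1 then Real.sqrt (lam 1 ^ 2 - kt₁ ^ 2) else Real.sqrt (lam i ^ 2 + kt₁ ^ 2)

/-- `θ₁ = λ₁ σ - arcosh (λ₁/b₁)` and `θᵢ = λᵢ σ + arccos (λᵢ/bᵢ)` for `i ≥ 2`. -/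
def thetaAngle (kt₁ : ℝ) (lam : ℕ → ℝ) (i : ℕ) (σ : ℝ) : ℝ :=
  if i = 1 then lam 1 * σ - Real.arcosh (lam 1 / bCoeff kt₁ lam 1)
  else lam i * σ + Real.arccos (lam i / bCoeff kt₁ lam i)

/-- The amplitude `(aᵢ/bᵢ) e^{κ̃₁ σ}`. -/
def amplitude (kt₁ : ℝ) (lam a : ℕ → ℝ) (i : ℕ) (σ : ℝ) : ℝ :=
  a i / bCoeff kt₁ lam i * Real.exp (kt₁ * σ)

/-- The explicit timelike curve: its coordinates `2i - 1, 2i` (counted from `1`) are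
`(aᵢ/bᵢ) e^{κ̃₁ σ} (sinh θ₁, cosh θ₁)` for `i = 1` and
`(aᵢ/bᵢ) e^{κ̃₁ σ} (sin θᵢ, -cos θᵢ)` for `i ≥ 2`. -/
def timelikeModel (k : ℕ) (kt₁ : ℝ) (lam a : ℕ → ℝ) (σ : ℝ) : Fin (2 * k) → ℝ := fun j =>
  if (j : ℕ) = 0 then amplitude kt₁ lam a 1 σ * Real.sinh (thetaAngle kt₁ lam 1 σ)
  else if (j : ℕ) = 1 then amplitude kt₁ lam a 1 σ * Real.cosh (thetaAngle kt₁ lam 1 σ)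
  else if (j : ℕ) % 2 = 0 then
    amplitude kt₁ lam a (j / 2 + 1) σ * Real.sin (thetaAngle kt₁ lam (j / 2 + 1) σ)
  else -(amplitude kt₁ lam a (j / 2 + 1) σ * Real.cos (thetaAngle kt₁ lam (j / 2 + 1) σ))

/-- The explicit spacelike curve: its coordinates `2i - 1, 2i` (counted from `1`) are
`-(aᵢ/bᵢ) e^{κ̃₁ σ} (cosh θ₁, sinh θ₁)` for `i = 1` and
`(aᵢ/bᵢ) e^{κ̃₁ σ} (sin θᵢ, -cos θᵢ)` for `i ≥ 2`. -/
def spacelikeModel (k : ℕ) (kt₁ : ℝ) (lam a : ℕ → ℝ) (σ : ℝ) : Fin (2 * k) → ℝ := fun j =>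
  if (j : ℕ) = 0 then -(amplitude kt₁ lam a 1 σ * Real.cosh (thetaAngle kt₁ lam 1 σ))
  else if (j : ℕ) = 1 then -(amplitude kt₁ lam a 1 σ * Real.sinh (thetaAngle kt₁ lam 1 σ))
  else if (j : ℕ) % 2 = 0 then
    amplitude kt₁ lam a (j / 2 + 1) σ * Real.sin (thetaAngle kt₁ lam (j / 2 + 1) σ)
  else -(amplitude kt₁ lam a (j / 2 + 1) σ * Real.cos (thetaAngle kt₁ lam (j / 2 + 1) σ))

/-- The vectors computed from a parametrized curve `c` by
`E₁ = e^{-κ̃₁ σ} c'`, `E₂ = ε₂ E₁'`, `E₃ = (1/(ε₃ κ̃₂)) (ε₁ E₁ + E₂')` and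
`E_{i+2} = (1/(ε_{i+2} κ̃_{i+1})) (ε_i κ̃_i E_i + E_{i+1}')` for `i ≥ 2`; `E 0` is a dummy. -/
def frameOf {n : ℕ} (ε kt : ℕ → ℝ) (c : ℝ → Fin n → ℝ) : ℕ → ℝ → Fin n → ℝ
  | 0 => fun _ => 0
  | 1 => fun σ => Real.exp (-(kt 1 * σ)) • deriv c σ
  | i + 2 => fun σ => (ε (i + 2) * curvRatio kt (i + 1))⁻¹ •
      ((ε i * curvRatio kt i) • frameOf ε kt c i σ + deriv (frameOf ε kt c (i + 1)) σ)

end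

open Matrix

/-! With the frame vectors as rows of a matrix `E`, the frame equations are the linear system `E' =
M E` with constant `M`. It suffices to exhibit one pseudo-orthonormal solution `F` and to compare it
with `E`. The matrix `M` is skew-adjoint for `T = diag(ε)`, so `Fᵀ T E` is constant, and this
constant yields the pseudo-orthogonal `A` (`exists_isPseudoOrthogonal`). Since `κ̃₁` is constant,
`κ₁ e^{κ̃₁ σ}` is a constant `c`, and integrating `α' = e₁ / κ₁` turns congruence of frames into
similarity of curves (`similar_of_modelFrame`).

The solution `F` comes from `M²`, which is `T`-self-adjoint. As `M` exchanges even and odd positions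
(counted from `0`), each eigenvalue `νᵢ` has an eigenvector `xᵢ` supported on even positions, and `M
xᵢ` is supported on odd ones. Because the `νᵢ` differ, the `M`-invariant planes spanned by `xᵢ` and
`M xᵢ` are mutually orthogonal, and the `k` of them fill the space. A positive `νᵢ` makes `xᵢ` or `M
xᵢ` timelike, depending on the case; two timelike vectors are never orthogonal, so only `ν₁` is
positive (`exists_orthonormal_eigenvectors`). Thus `M` generates boosts in the first plane and
rotations in the others.

The first coordinate of `M xᵢ` vanishes, so the first row of `F` involves only the first coordinates
of the `xᵢ`. These are the `aᵢ`, and `e^{κ̃₁ σ}` times that row is the derivative of the explicit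
curve. Orientation is corrected by the free sign of `λ₂`; for `k = 1` it is automatically right
(`IsAdaptedBasis.exists_det_pos`). -/

/-- The Gram matrix `diag(ε₁, …, εₙ)` of a pseudo-orthonormal frame. -/
def signMatrix (n : ℕ) (ε : ℕ → ℝ) : Matrix (Fin n) (Fin n) ℝ :=
  Matrix.diagonal fun i => ε (i + 1)

/-- The parity operator `diag(1, -1, 1, -1, …)`. -/
def parityMatrix (n : ℕ) : Matrix (Fin n) (Fin n) ℝ :=
  Matrix.diagonal fun i => (-1) ^ (i : ℕ)

/-! ### Diagonal forms with at most one negative direction `p`. -/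

section DiagonalForms

variable {n : ℕ} {d : Fin n → ℝ} {p : Fin n}

theorem diagonal_form_apply (d u v : Fin n → ℝ) :
    u ⬝ᵥ (diagonal d *ᵥ v) = ∑ i, d i * (u i * v i) := by
  simp only [dotProduct, mulVec_diagonal]
  exact Finset.sum_congr rfl fun i _ => by ring

theorem diagonal_form_comm (d u v : Fin n → ℝ) :
    u ⬝ᵥ (diagonal d *ᵥ v) = v ⬝ᵥ (diagonal d *ᵥ u) := by
  simp only [diagonal_form_apply]
  exact Finset.sum_congr rfl fun i _ => by ring

theorem diagonal_form_nonneg (hd : ∀ i, i ≠ p → d i = 1) {u : Fin n → ℝ} (hu : u p = 0) :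
    0 ≤ u ⬝ᵥ (diagonal d *ᵥ u) := by
  rw [diagonal_form_apply]
  refine Finset.sum_nonneg fun i _ => ?_
  by_cases h : i = p
  · subst h; simp [hu]
  · rw [hd i h, one_mul]; exact mul_self_nonneg _

theorem diagonal_form_pos (hd : ∀ i, i ≠ p → d i = 1) {u : Fin n → ℝ} (hu : u p = 0)
    (hne : u ≠ 0) : 0 < u ⬝ᵥ (diagonal d *ᵥ u) := by
  rw [diagonal_form_apply]
  obtain ⟨j, hj⟩ := Function.ne_iff.1 hne
  refine Finset.sum_pos' (fun i _ => ?_) ⟨j, Finset.mem_univ _, ?_⟩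
  · by_cases h : i = p
    · subst h; simp [hu]
    · rw [hd i h, one_mul]; exact mul_self_nonneg _
  · have h : j ≠ p := by rintro rfl; exact hj (by simpa using hu)
    rw [hd j h, one_mul]
    exact mul_self_pos.2 hj

/-- Two timelike vectors of a Lorentzian form are never orthogonal. -/
theorem diagonal_form_ne_zero_of_neg (hd : ∀ i, i ≠ p → d i = 1) {u v : Fin n → ℝ}
    (hu : u ⬝ᵥ (diagonal d *ᵥ u) < 0) (hv : v ⬝ᵥ (diagonal d *ᵥ v) < 0) :
    u ⬝ᵥ (diagonal d *ᵥ v) ≠ 0 := by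
  intro h0
  have hvp : v p ≠ 0 := fun h => absurd (diagonal_form_nonneg hd h) (not_le.2 hv)
  -- This combination has zero `p`-coordinate, so its square is nonnegative; if `u` and `v` were
  -- orthogonal it would be `v_p² (u·u) + u_p² (v·v) < 0`.
  have hw := diagonal_form_nonneg (u := v p • u - u p • v) hd (by simp; ring)
  have hvu := diagonal_form_comm d v u
  simp only [mulVec_sub, mulVec_smul, dotProduct_sub, sub_dotProduct, smul_dotProduct,
    dotProduct_smul, smul_eq_mul, h0, hvu] at hw
  nlinarith [mul_pos (mul_self_pos.2 hvp) (neg_pos.2 hu), mul_self_nonneg (u p)]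

end DiagonalForms

/-! ### Symmetries and recursions of the tridiagonal matrix `M`. -/

section ShapeMatrix

variable {n : ℕ} {ε kt : ℕ → ℝ}

/-- The values lie in an arbitrary module so that one formula serves both the Frenet equations
(vectors) and `mulVec` (scalars). As `W` is indexed from `1`, row `i` meets `W i` and `W (i + 2)`.
-/
theorem shapeMatrix_sum_smul {V : Type*} [AddCommGroup V] [Module ℝ V] (ε kt : ℕ → ℝ)
    (i : Fin n) (W : ℕ → V) :
    ∑ j : Fin n, shapeMatrix n ε kt i j • W (j + 1) =
      (if 1 < (i : ℕ) + 1 then -(ε i * curvRatio kt i) • W i else 0) +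
        (if (i : ℕ) + 1 < n then (ε (i + 2) * curvRatio kt (i + 1)) • W (i + 2) else 0) := by
  have h : ∀ j : Fin n, shapeMatrix n ε kt i j • W (j + 1) =
      (if (i : ℕ) = j + 1 then -(ε i * curvRatio kt i) • W i else 0) +
        (if (j : ℕ) = i + 1 then (ε (i + 2) * curvRatio kt (i + 1)) • W (i + 2) else 0) := by
    intro j
    simp only [shapeMatrix, of_apply]
    by_cases h1 : (j : ℕ) = i + 1
    · have h2 : ¬ (i : ℕ) = j + 1 := by omega
      rw [if_pos h1, if_neg h2, if_pos h1, zero_add, h1]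
    · by_cases h2 : (i : ℕ) = j + 1
      · rw [if_neg h1, if_pos h2, if_pos h2, if_neg h1, add_zero, h2]
      · simp [h1, h2]
  simp only [h, Finset.sum_add_distrib]
  congr 1
  · by_cases hi : 1 < (i : ℕ) + 1
    · rw [if_pos hi, Finset.sum_eq_single ⟨i - 1, by omega⟩]
      · rw [if_pos]; simp; omega
      · intro j _ hj
        rw [if_neg]
        intro h'; apply hj; ext; simp; omega
      · simp
    · rw [if_neg hi]
      exact Finset.sum_eq_zero fun j _ => if_neg (by omega)
  · by_cases hi : (i : ℕ) + 1 < n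
    · rw [if_pos hi, Finset.sum_eq_single ⟨i + 1, hi⟩]
      · simp
      · intro j _ hj
        rw [if_neg]
        intro h'; apply hj; ext; simpa using h'
      · simp
    · rw [if_neg hi]
      exact Finset.sum_eq_zero fun j _ => if_neg (by omega)

theorem shapeMatrix_mulVec_apply (ε kt : ℕ → ℝ) (i : Fin n) (w : ℕ → ℝ) :
    (shapeMatrix n ε kt *ᵥ fun j => w (j + 1)) i =
      (if 1 < (i : ℕ) + 1 then -(ε i * curvRatio kt i) * w i else 0) +
        (if (i : ℕ) + 1 < n then (ε (i + 2) * curvRatio kt (i + 1)) * w (i + 2) else 0) := by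
  have := shapeMatrix_sum_smul ε kt i w
  simp only [smul_eq_mul] at this
  rw [← this]; rfl

/-- Skew-adjointness for the form `diag(ε)`: the infinitesimal version of the frame staying
pseudo-orthonormal. It makes `M²` self-adjoint. -/
theorem shapeMatrix_transpose_mul_signMatrix (n : ℕ) (ε kt : ℕ → ℝ) :
    (shapeMatrix n ε kt)ᵀ * signMatrix n ε = -(signMatrix n ε * shapeMatrix n ε kt) := by
  ext i j
  simp only [signMatrix, mul_diagonal, diagonal_mul, Matrix.neg_apply, transpose_apply, shapeMatrix,
    of_apply]
  by_cases h1 : (j : ℕ) = i + 1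
  · simp only [h1, if_true]
    rw [if_neg (by omega)]; ring
  · by_cases h2 : (i : ℕ) = j + 1
    · simp only [h2, if_true]
      rw [if_neg (by omega)]; ring
    · simp [h1, h2]

/-- Every nonzero entry of `M` joins neighbouring positions, so `M` exchanges the two parity
eigenspaces. -/
theorem shapeMatrix_mul_parityMatrix (n : ℕ) (ε kt : ℕ → ℝ) :
    shapeMatrix n ε kt * parityMatrix n = -(parityMatrix n * shapeMatrix n ε kt) := by
  ext i j
  simp only [parityMatrix, mul_diagonal, diagonal_mul, Matrix.neg_apply, shapeMatrix, of_apply]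
  by_cases h1 : (j : ℕ) = i + 1
  · simp only [h1, if_true, pow_succ]; ring
  · by_cases h2 : (i : ℕ) = j + 1
    · simp only [h2, if_true, pow_succ]; rw [if_neg (by omega)]; ring
    · simp [h1, h2]

theorem parityMatrix_mul_self (n : ℕ) : parityMatrix n * parityMatrix n = 1 := by
  simp [parityMatrix, diagonal_mul_diagonal, ← mul_pow]

theorem parityMatrix_mulVec_shapeMatrix (ε kt : ℕ → ℝ) (x : Fin n → ℝ) :
    parityMatrix n *ᵥ (shapeMatrix n ε kt *ᵥ x) =
      -(shapeMatrix n ε kt *ᵥ (parityMatrix n *ᵥ x)) := by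
  rw [mulVec_mulVec, mulVec_mulVec, shapeMatrix_mul_parityMatrix, neg_mulVec, neg_neg]

theorem form_shapeMatrix_left (ε kt : ℕ → ℝ) (u v : Fin n → ℝ) :
    (shapeMatrix n ε kt *ᵥ u) ⬝ᵥ (signMatrix n ε *ᵥ v) =
      -(u ⬝ᵥ (signMatrix n ε *ᵥ (shapeMatrix n ε kt *ᵥ v))) := by
  rw [dotProduct_comm, dotProduct_mulVec, ← mulVec_transpose, dotProduct_comm, mulVec_mulVec,
    shapeMatrix_transpose_mul_signMatrix, neg_mulVec, dotProduct_neg, mulVec_mulVec]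

theorem form_eq_zero_of_parity {u v : Fin n → ℝ} (hu : parityMatrix n *ᵥ u = u)
    (hv : parityMatrix n *ᵥ v = -v) : u ⬝ᵥ (signMatrix n ε *ᵥ v) = 0 := by
  rw [signMatrix, diagonal_form_apply]
  refine Finset.sum_eq_zero fun i _ => ?_
  have h1 := congrFun hu i
  have h2 := congrFun hv i
  simp only [parityMatrix, mulVec_diagonal, Pi.neg_apply] at h1 h2
  rcases neg_one_pow_eq_or ℝ (i : ℕ) with h | h
  · have : v i = 0 := by rw [h] at h2; linarith
    simp [this]
  · have : u i = 0 := by rw [h] at h1; linarith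
    simp [this]

/-- The values of a vector on `Fin n`, indexed from `1` and extended by zero. -/
def extendOne (x : Fin n → ℝ) (m : ℕ) : ℝ :=
  if h : m - 1 < n then x ⟨m - 1, h⟩ else 0

theorem extendOne_succ (x : Fin n → ℝ) (j : Fin n) : extendOne x (j + 1) = x j := by
  simp [extendOne]

theorem shapeMatrix_mulVec_row (ε kt : ℕ → ℝ) (x : Fin n → ℝ) (i : Fin n) :
    (shapeMatrix n ε kt *ᵥ x) i =
      (if 1 < (i : ℕ) + 1 then -(ε i * curvRatio kt i) * extendOne x i else 0) +
        (if (i : ℕ) + 1 < n then (ε (i + 2) * curvRatio kt (i + 1)) * extendOne x (i + 2)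
          else 0) := by
  rw [← shapeMatrix_mulVec_apply]
  simp only [extendOne_succ]

theorem eq_zero_of_extendOne {x : Fin n → ℝ} (h : ∀ m < n, extendOne x (m + 1) = 0) : x = 0 := by
  ext i
  simpa [extendOne_succ] using h i i.2

/-- A vector in a shift-like eigenspace of the square of a Jacobi matrix vanishes as soon as its
first coordinate and that of its image do. -/
theorem eq_zero_of_shapeMatrix_sq (hε : ∀ i ∈ Set.Icc 1 n, ε i ≠ 0)
    (hk : ∀ i ∈ Set.Icc 1 (n - 1), curvRatio kt i ≠ 0) (hn : 0 < n) {x : Fin n → ℝ} {r : ℝ}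
    (h : shapeMatrix n ε kt *ᵥ (shapeMatrix n ε kt *ᵥ x) = r • x) (h0 : x ⟨0, hn⟩ = 0)
    (h1 : (shapeMatrix n ε kt *ᵥ x) ⟨0, hn⟩ = 0) : x = 0 := by
  set y := shapeMatrix n ε kt *ᵥ x with hy
  have key : ∀ m, m < n → ∀ l ≤ m, extendOne x (l + 1) = 0 ∧ extendOne y (l + 1) = 0 := by
    intro m
    induction m with
    | zero =>
      intro _ l hl
      obtain rfl : l = 0 := by omega
      exact ⟨by simpa [extendOne, hn] using h0, by simpa [extendOne, hn] using h1⟩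
    | succ m ih =>
      intro hm l hl
      rcases Nat.lt_or_ge l (m + 1) with hl' | hl'
      · exact ih (by omega) l (by omega)
      obtain rfl : l = m + 1 := by omega
      have hm' : m < n := by omega
      have hc : ε (m + 2) * curvRatio kt (m + 1) ≠ 0 :=
        mul_ne_zero (hε _ ⟨by omega, by omega⟩) (hk _ ⟨by omega, by omega⟩)
      -- Row `m` of `M z` gives the next coordinate of `z` in terms of an earlier one. This is
      -- applied to `x`, with image `y`, and to `y`, with image `r • x`, in one induction.
      have hprev : ∀ z : Fin n → ℝ, (∀ l ≤ m, extendOne z (l + 1) = 0) →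
          (shapeMatrix n ε kt *ᵥ z) ⟨m, hm'⟩ = 0 → extendOne z (m + 2) = 0 := by
        intro z hz h'
        rw [shapeMatrix_mulVec_row] at h'
        simp only [hm, if_true] at h'
        have : (if 1 < m + 1 then -(ε m * curvRatio kt m) * extendOne z m else 0) = 0 := by
          split_ifs with hh
          · have := hz (m - 1) (by omega)
            rw [Nat.sub_add_cancel (by omega)] at this
            rw [this, mul_zero]
          · rfl
        rw [this, zero_add] at h'
        exact (mul_eq_zero.1 h').resolve_left hc
      have hxm := (ih hm' m le_rfl).1
      have hym := (ih hm' m le_rfl).2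
      rw [show m + 1 = ((⟨m, hm'⟩ : Fin n) : ℕ) + 1 from rfl, extendOne_succ] at hxm hym
      refine ⟨hprev x (fun l hl => (ih hm' l hl).1) (by rw [← hy]; exact hym),
        hprev y (fun l hl => (ih hm' l hl).2) ?_⟩
      rw [h, Pi.smul_apply, hxm, smul_zero]
  exact eq_zero_of_extendOne fun m hm => (key m hm m le_rfl).1

/-- The diagonal is zero, so the equations decouple by parity. Counting coordinates from `1`, the
even ones vanish successively from the top row down, the odd ones from the bottom row up; both
chains start because the size is even. -/
theorem eq_zero_of_shapeMatrix {k : ℕ} (hε : ∀ i ∈ Set.Icc 1 (2 * k), ε i ≠ 0)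
    (hk : ∀ i ∈ Set.Icc 1 (2 * k - 1), curvRatio kt i ≠ 0) {x : Fin (2 * k) → ℝ}
    (h : shapeMatrix (2 * k) ε kt *ᵥ x = 0) : x = 0 := by
  have hc : ∀ m, m + 1 < 2 * k → ε (m + 2) * curvRatio kt (m + 1) ≠ 0 := fun m hm =>
    mul_ne_zero (hε _ ⟨by omega, by omega⟩) (hk _ ⟨by omega, by omega⟩)
  have hc' : ∀ m, 0 < m → m < 2 * k → -(ε m * curvRatio kt m) ≠ 0 := fun m h0 hm =>
    neg_ne_zero.2 (mul_ne_zero (hε _ ⟨by omega, by omega⟩) (hk _ ⟨by omega, by omega⟩))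
  have hrow : ∀ m (hm : m < 2 * k),
      (if 1 < m + 1 then -(ε m * curvRatio kt m) * extendOne x m else 0) +
        (if m + 1 < 2 * k then (ε (m + 2) * curvRatio kt (m + 1)) * extendOne x (m + 2)
          else 0) = 0 := by
    intro m hm
    have := shapeMatrix_mulVec_row ε kt x ⟨m, hm⟩
    rw [h] at this
    exact this.symm
  have heven : ∀ m, m < k → extendOne x (2 * m + 2) = 0 := by
    intro m
    induction m with
    | zero =>
      intro hm
      have := hrow 0 (by omega)
      rw [if_neg (by omega), if_pos (by omega), zero_add] at this
      exact (mul_eq_zero.1 this).resolve_left (hc 0 (by omega))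
    | succ m ih =>
      intro hm
      have := hrow (2 * m + 2) (by omega)
      rw [if_pos (by omega), if_pos (by omega), ih (by omega), mul_zero, zero_add] at this
      exact (mul_eq_zero.1 this).resolve_left (hc _ (by omega))
  have hodd : ∀ m, m < k → extendOne x (2 * (k - 1 - m) + 1) = 0 := by
    intro m
    induction m with
    | zero =>
      intro hm
      have := hrow (2 * (k - 1) + 1) (by omega)
      rw [if_pos (by omega), if_neg (by omega), add_zero] at this
      exact (mul_eq_zero.1 this).resolve_left (hc' _ (by omega) (by omega))
    | succ m ih =>
      intro hm
      have := hrow (2 * (k - 1 - (m + 1)) + 1) (by omega)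
      have h2 := ih (by omega)
      rw [show 2 * (k - 1 - m) + 1 = 2 * (k - 1 - (m + 1)) + 1 + 2 by omega] at h2
      rw [if_pos (by omega), if_pos (by omega), h2, mul_zero, add_zero] at this
      exact (mul_eq_zero.1 this).resolve_left (hc' _ (by omega) (by omega))
  refine eq_zero_of_extendOne fun m hm => ?_
  rcases Nat.even_or_odd' m with ⟨l, rfl | rfl⟩
  · have := hodd (k - 1 - l) (by omega)
    rwa [show k - 1 - (k - 1 - l) = l by omega] at this
  · exact heven l (by omega)

end ShapeMatrix

/-! ### Eigenvectors and signs of the eigenvalues of `M²`. -/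

section Spectrum

variable {k : ℕ} {ε kt : ℕ → ℝ}

/-- Every eigenvalue of the square of the shape matrix has an eigenvector supported on the even
positions. -/
theorem exists_parity_eigenvector (hε : ∀ i ∈ Set.Icc 1 (2 * k), ε i ≠ 0)
    (hc : ∀ i ∈ Set.Icc 1 (2 * k - 1), curvRatio kt i ≠ 0) {r : ℝ}
    (h : Module.End.HasEigenvalue (Matrix.toLin' (shapeMatrix (2 * k) ε kt ^ 2)) r) :
    ∃ z : Fin (2 * k) → ℝ, z ≠ 0 ∧ parityMatrix (2 * k) *ᵥ z = z ∧
      shapeMatrix (2 * k) ε kt *ᵥ (shapeMatrix (2 * k) ε kt *ᵥ z) = r • z := by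
  obtain ⟨v, hv⟩ := h.exists_hasEigenvector
  have hv0 := hv.2
  have hve : shapeMatrix (2 * k) ε kt *ᵥ (shapeMatrix (2 * k) ε kt *ᵥ v) = r • v := by
    have := hv.apply_eq_smul
    rwa [Matrix.toLin'_apply, pow_two, ← mulVec_mulVec] at this
  have hQQ : ∀ w : Fin (2 * k) → ℝ, parityMatrix (2 * k) *ᵥ (parityMatrix (2 * k) *ᵥ w) = w := by
    intro w; rw [mulVec_mulVec, parityMatrix_mul_self, one_mulVec]
  -- The even part of `v` is again an eigenvector; if it is zero then `v` is odd, and the even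
  -- vector `M v` serves, being nonzero by injectivity.
  by_cases h0 : v + parityMatrix (2 * k) *ᵥ v = 0
  · have hQ : parityMatrix (2 * k) *ᵥ v = -v := eq_neg_of_add_eq_zero_right h0
    refine ⟨shapeMatrix (2 * k) ε kt *ᵥ v, fun h1 => hv0 (eq_zero_of_shapeMatrix hε hc h1), ?_, ?_⟩
    · rw [parityMatrix_mulVec_shapeMatrix, hQ, mulVec_neg, neg_neg]
    · rw [hve, mulVec_smul]
  · refine ⟨_, h0, ?_, ?_⟩
    · rw [mulVec_add, hQQ, add_comm]
    · have : shapeMatrix (2 * k) ε kt *ᵥ (shapeMatrix (2 * k) ε kt *ᵥ (parityMatrix (2 * k) *ᵥ v)) =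
          r • (parityMatrix (2 * k) *ᵥ v) := by
        rw [← neg_neg (shapeMatrix (2 * k) ε kt *ᵥ (parityMatrix (2 * k) *ᵥ v)),
          ← parityMatrix_mulVec_shapeMatrix, mulVec_neg, ← parityMatrix_mulVec_shapeMatrix, hve,
          mulVec_smul]
      rw [mulVec_add, mulVec_add, hve, this, smul_add]

theorem parity_shapeMatrix_mulVec {z : Fin (2 * k) → ℝ} (hz : parityMatrix (2 * k) *ᵥ z = z) :
    parityMatrix (2 * k) *ᵥ (shapeMatrix (2 * k) ε kt *ᵥ z) = -(shapeMatrix (2 * k) ε kt *ᵥ z) := by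
  rw [parityMatrix_mulVec_shapeMatrix, hz]

theorem apply_eq_zero_of_parity_neg {z : Fin (2 * k) → ℝ} (hz : parityMatrix (2 * k) *ᵥ z = -z)
    {i : Fin (2 * k)} (hi : Even (i : ℕ)) : z i = 0 := by
  have := congrFun hz i
  simp only [parityMatrix, mulVec_diagonal, Pi.neg_apply, hi.neg_one_pow] at this
  linarith

theorem apply_eq_zero_of_parity {z : Fin (2 * k) → ℝ} (hz : parityMatrix (2 * k) *ᵥ z = z)
    {i : Fin (2 * k)} (hi : Odd (i : ℕ)) : z i = 0 := by
  have := congrFun hz i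
  simp only [parityMatrix, mulVec_diagonal, hi.neg_one_pow] at this
  linarith

/-- The spectral theorem for the square of the shape matrix with simple spectrum: an orthonormal
system of eigenvectors, all eigenvalues but the first being negative. -/
theorem exists_orthonormal_eigenvectors (hk : 1 ≤ k) (hε : ∀ i ∈ Set.Icc 1 (2 * k), ε i ≠ 0)
    (hc : ∀ i ∈ Set.Icc 1 (2 * k - 1), curvRatio kt i ≠ 0)
    {p : ℕ} (hp : p = 1 ∨ p = 2) (hεp : ε p = -1)
    (hε1 : ∀ i ∈ Set.Icc 1 (2 * k), i ≠ p → ε i = 1)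
    {ν : ℕ → ℝ} (hνinj : Set.InjOn ν (Set.Icc 1 k))
    (hν : ∀ i ∈ Set.Icc 1 k,
      Module.End.HasEigenvalue (Matrix.toLin' (shapeMatrix (2 * k) ε kt ^ 2)) (ν i))
    (hpos : 0 < ν 1) :
    (∀ i ∈ Set.Icc 2 k, ν i < 0) ∧
    ∃ x : ℕ → Fin (2 * k) → ℝ,
      (∀ i ∈ Set.Icc 1 k, parityMatrix (2 * k) *ᵥ x i = x i) ∧
      (∀ i ∈ Set.Icc 1 k,
        shapeMatrix (2 * k) ε kt *ᵥ (shapeMatrix (2 * k) ε kt *ᵥ x i) = ν i • x i) ∧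
      (∀ i ∈ Set.Icc 1 k, x i ⟨0, by omega⟩ ≠ 0) ∧
      (∀ i ∈ Set.Icc 1 k, ∀ j ∈ Set.Icc 1 k, x i ⬝ᵥ (signMatrix (2 * k) ε *ᵥ x j) =
        if i = j then (if i = 1 then ε 1 else 1) else 0) := by
  have hex : ∀ i, ∃ z : Fin (2 * k) → ℝ, i ∈ Set.Icc 1 k →
      (z ≠ 0 ∧ parityMatrix (2 * k) *ᵥ z = z ∧
      shapeMatrix (2 * k) ε kt *ᵥ (shapeMatrix (2 * k) ε kt *ᵥ z) = ν i • z) := by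
    intro i
    by_cases hi : i ∈ Set.Icc 1 k
    · obtain ⟨z, hz⟩ := exists_parity_eigenvector hε hc (hν i hi)
      exact ⟨z, fun _ => hz⟩
    · exact ⟨0, fun h => absurd h hi⟩
  choose z hz using hex
  set N := shapeMatrix (2 * k) ε kt with hN
  set T := signMatrix (2 * k) ε with hT
  have h1mem : 1 ∈ Set.Icc 1 k := ⟨le_rfl, hk⟩
  -- Symmetry of the left side in `i` and `j` gives orthogonality for distinct eigenvalues; the
  -- diagonal case links the sign of `ν i` to the causal characters of `z i` and `N *ᵥ z i`.
  have hNform : ∀ i ∈ Set.Icc 1 k, ∀ j ∈ Set.Icc 1 k,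
      (N *ᵥ z i) ⬝ᵥ (T *ᵥ (N *ᵥ z j)) = -ν j * (z i ⬝ᵥ (T *ᵥ z j)) := by
    intro i _ j hj
    rw [hN, hT, form_shapeMatrix_left, (hz j hj).2.2, mulVec_smul, dotProduct_smul, smul_eq_mul,
      neg_mul]
  have hcomm : ∀ u v : Fin (2 * k) → ℝ, u ⬝ᵥ (T *ᵥ v) = v ⬝ᵥ (T *ᵥ u) := fun u v =>
    diagonal_form_comm _ u v
  have horth : ∀ i ∈ Set.Icc 1 k, ∀ j ∈ Set.Icc 1 k, i ≠ j → z i ⬝ᵥ (T *ᵥ z j) = 0 := by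
    intro i hi j hj hij
    have h1 := hNform i hi j hj
    have h2 := hNform j hj i hi
    rw [hcomm, h1, hcomm (z j)] at h2
    have : (ν i - ν j) * (z i ⬝ᵥ (T *ᵥ z j)) = 0 := by linarith
    exact (mul_eq_zero.1 this).resolve_left fun h => hij (hνinj hi hj (sub_eq_zero.1 h))
  have hNz : ∀ i ∈ Set.Icc 1 k, N *ᵥ z i ≠ 0 := fun i hi h =>
    (hz i hi).1 (eq_zero_of_shapeMatrix hε hc h)
  have hν0 : ∀ i ∈ Set.Icc 1 k, ν i ≠ 0 := by
    intro i hi h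
    have := (hz i hi).2.2
    rw [h, zero_smul] at this
    exact hNz i hi (eq_zero_of_shapeMatrix hε hc this)
  have hd : ∀ q : Fin (2 * k), (q : ℕ) + 1 = p →
      ∀ i, i ≠ q → (fun i : Fin (2 * k) => ε (i + 1)) i = 1 := by
    intro q hq i hi
    refine hε1 _ ⟨by omega, by omega⟩ fun h => hi (Fin.ext (by omega))
  have main : (∀ i ∈ Set.Icc 2 k, ν i < 0) ∧ 0 < ε 1 * (z 1 ⬝ᵥ (T *ᵥ z 1)) ∧
      ∀ i ∈ Set.Icc 2 k, 0 < z i ⬝ᵥ (T *ᵥ z i) := by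
    -- If `e₁` is timelike, odd vectors are spacelike, so a positive `ν i` forces `z i` to be
    -- timelike. If `e₂` is timelike, even vectors are spacelike and `N *ᵥ z i` becomes timelike.
    -- Either way a second positive eigenvalue would give two orthogonal timelike vectors.
    rcases hp with rfl | rfl
    · have hd' := hd ⟨0, by omega⟩ rfl
      have hNpos : ∀ i ∈ Set.Icc 1 k, 0 < -ν i * (z i ⬝ᵥ (T *ᵥ z i)) := by
        intro i hi
        rw [← hNform i hi i hi]
        exact diagonal_form_pos hd'
          (apply_eq_zero_of_parity_neg (parity_shapeMatrix_mulVec (hz i hi).2.1) (by simp))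
          (hNz i hi)
      have h1 : z 1 ⬝ᵥ (T *ᵥ z 1) < 0 := by
        have := hNpos 1 h1mem
        by_contra hcon
        nlinarith [mul_nonneg hpos.le (not_lt.1 hcon)]
      have hneg : ∀ i ∈ Set.Icc 2 k, ν i < 0 := by
        intro i hi
        have hi1 : i ∈ Set.Icc 1 k := ⟨by have := hi.1; omega, hi.2⟩
        by_contra hcon
        have hνi := lt_of_le_of_ne (not_lt.1 hcon) (hν0 i hi1).symm
        have h2 : z i ⬝ᵥ (T *ᵥ z i) < 0 := by
          have := hNpos i hi1
          by_contra hcon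
          nlinarith [mul_nonneg hνi.le (not_lt.1 hcon)]
        exact diagonal_form_ne_zero_of_neg hd' h1 h2
          (horth 1 h1mem i hi1 (by have := hi.1; omega))
      refine ⟨hneg, by rw [hεp]; linarith, fun i hi => ?_⟩
      have hi1 : i ∈ Set.Icc 1 k := ⟨by have := hi.1; omega, hi.2⟩
      exact pos_of_mul_pos_right (hNpos i hi1) (by linarith [hneg i hi])
    · have hd' := hd ⟨1, by omega⟩ rfl
      have hzpos : ∀ i ∈ Set.Icc 1 k, 0 < z i ⬝ᵥ (T *ᵥ z i) := fun i hi =>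
        diagonal_form_pos hd' (apply_eq_zero_of_parity (hz i hi).2.1 (by simp)) (hz i hi).1
      have hneg' : ∀ i ∈ Set.Icc 1 k, 0 < ν i → (N *ᵥ z i) ⬝ᵥ (T *ᵥ (N *ᵥ z i)) < 0 := by
        intro i hi h
        rw [hNform i hi i hi]
        nlinarith [mul_pos h (hzpos i hi)]
      refine ⟨fun i hi => ?_, ?_, fun i hi => hzpos i ⟨by have := hi.1; omega, hi.2⟩⟩
      · have hi1 : i ∈ Set.Icc 1 k := ⟨by have := hi.1; omega, hi.2⟩
        by_contra hcon
        have hνi := lt_of_le_of_ne (not_lt.1 hcon) (hν0 i hi1).symm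
        refine diagonal_form_ne_zero_of_neg hd' (hneg' 1 h1mem hpos) (hneg' i hi1 hνi) ?_
        have := hNform 1 h1mem i hi1
        rw [horth 1 h1mem i hi1 (by have := hi.1; omega), mul_zero] at this
        exact this
      · rw [hε1 1 ⟨le_rfl, by omega⟩ (by omega), one_mul]
        exact hzpos 1 h1mem
  obtain ⟨hneg, hz1, hzi⟩ := main
  have hε1sq : ε 1 * ε 1 = 1 := by
    rcases hp with rfl | rfl
    · rw [hεp]; norm_num
    · rw [hε1 1 ⟨le_rfl, by omega⟩ (by omega)]; norm_num
  have hnz : ∀ i ∈ Set.Icc 1 k, z i ⬝ᵥ (T *ᵥ z i) ≠ 0 := by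
    intro i hi
    by_cases h : i = 1
    · subst h; intro h; rw [h, mul_zero] at hz1; exact lt_irrefl _ hz1
    · exact (hzi i ⟨by have := hi.1; omega, hi.2⟩).ne'
  set s : ℕ → ℝ := fun i => (Real.sqrt |z i ⬝ᵥ (T *ᵥ z i)|)⁻¹ with hs
  have hs0 : ∀ i ∈ Set.Icc 1 k, s i ≠ 0 := fun i hi =>
    inv_ne_zero (Real.sqrt_ne_zero'.2 (abs_pos.2 (hnz i hi)))
  have hss : ∀ i, s i * s i = |z i ⬝ᵥ (T *ᵥ z i)|⁻¹ := by
    intro i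
    simp only [hs]
    rw [← mul_inv, Real.mul_self_sqrt (abs_nonneg _)]
  refine ⟨hneg, fun i => s i • z i, fun i hi => ?_, fun i hi => ?_, fun i hi => ?_,
    fun i hi j hj => ?_⟩
  · rw [mulVec_smul, (hz i hi).2.1]
  · rw [mulVec_smul, mulVec_smul, (hz i hi).2.2, smul_comm]
  -- The image of the even vector `z i` is odd, so its first coordinate is already zero; if that of
  -- `z i` were zero too, the recursion would annihilate `z i`.
  · intro h0
    have hzi0 : z i ⟨0, by omega⟩ = 0 := (mul_eq_zero.1 h0).resolve_left (hs0 i hi)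
    exact (hz i hi).1 (eq_zero_of_shapeMatrix_sq hε hc (by omega) (hz i hi).2.2 hzi0
      (apply_eq_zero_of_parity_neg (parity_shapeMatrix_mulVec (hz i hi).2.1) (by simp)))
  · rw [smul_dotProduct, mulVec_smul, dotProduct_smul, smul_eq_mul, smul_eq_mul]
    by_cases hij : i = j
    · subst hij
      rw [if_pos rfl, ← mul_assoc, hss, ← div_eq_inv_mul]
      by_cases h1 : i = 1
      · subst h1
        rw [if_pos rfl]
        have : |z 1 ⬝ᵥ (T *ᵥ z 1)| = ε 1 * (z 1 ⬝ᵥ (T *ᵥ z 1)) := by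
          rw [← abs_of_pos hz1, abs_mul]
          have : |ε 1| = 1 := by
            rcases mul_self_eq_one_iff.1 hε1sq with h | h <;> simp [h]
          rw [this, one_mul]
        rw [this, div_eq_iff hz1.ne', ← mul_assoc, hε1sq, one_mul]
      · rw [if_neg h1, abs_of_pos (hzi i ⟨by have := hi.1; omega, hi.2⟩), div_self (hnz i hi)]
    · rw [if_neg hij, horth i hi j hj hij, mul_zero, mul_zero]

end Spectrum

/-! ### The adapted basis and the block form of `M`. -/

/-- The equivalence splitting a position in `Fin (2 * k)` into its parity and its half. -/
def parityEquiv (k : ℕ) : Fin (2 * k) ≃ Fin 2 × Fin k where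
  toFun j := (⟨j % 2, Nat.mod_lt _ two_pos⟩, ⟨j / 2, by omega⟩)
  invFun q := ⟨2 * q.2 + q.1, by omega⟩
  left_inv j := by ext; simp; omega
  right_inv q := by
    ext
    · simp; omega
    · simp; omega

/-- Eigenvectors of the square of the shape matrix, normalised for the form of signs `ε`, together
with square roots of the absolute values of the eigenvalues. -/
structure IsAdaptedBasis (k : ℕ) (ε kt ν lam : ℕ → ℝ) (x : ℕ → Fin (2 * k) → ℝ) : Prop where
  sign_sq : ε 1 * ε 1 = 1
  parity : ∀ i ∈ Set.Icc 1 k, parityMatrix (2 * k) *ᵥ x i = x i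
  eigen : ∀ i ∈ Set.Icc 1 k,
    shapeMatrix (2 * k) ε kt *ᵥ (shapeMatrix (2 * k) ε kt *ᵥ x i) = ν i • x i
  gram : ∀ i ∈ Set.Icc 1 k, ∀ j ∈ Set.Icc 1 k, x i ⬝ᵥ (signMatrix (2 * k) ε *ᵥ x j) =
    if i = j then (if i = 1 then ε 1 else 1) else 0
  lam_ne : ∀ i ∈ Set.Icc 1 k, lam i ≠ 0
  first : ν 1 = lam 1 ^ 2
  later : ∀ i ∈ Set.Icc 2 k, ν i = -lam i ^ 2

/-- The matrix with columns `xᵢ` and `λᵢ⁻¹ M xᵢ`. -/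
noncomputable def columnMatrix (k : ℕ) (ε kt lam : ℕ → ℝ) (x : ℕ → Fin (2 * k) → ℝ) :
    Matrix (Fin (2 * k)) (Fin 2 × Fin k) ℝ :=
  Matrix.of fun r q => if q.1 = 0 then x (q.2 + 1) r
    else (lam (q.2 + 1))⁻¹ * (shapeMatrix (2 * k) ε kt *ᵥ x (q.2 + 1)) r

/-- The Gram matrix of the pair `xᵢ`, `λᵢ⁻¹ M xᵢ`. -/
def pairGram (s : ℝ) (i : ℕ) : Matrix (Fin 2) (Fin 2) ℝ :=
  if i = 0 then diagonal ![s, -s] else 1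

/-- The matrix of `M` on the plane spanned by `xᵢ` and `λᵢ⁻¹ M xᵢ`. -/
noncomputable def pairGenerator (ν lam : ℕ → ℝ) (i : ℕ) : Matrix (Fin 2) (Fin 2) ℝ :=
  !![0, ν (i + 1) / lam (i + 1); lam (i + 1), 0]

theorem transpose_mul_mul_apply {m n : Type*} [Fintype m] (T : Matrix m m ℝ) (A : Matrix m n ℝ)
    (p q : n) : (Aᵀ * (T * A)) p q = (fun r => A r p) ⬝ᵥ (T *ᵥ fun r => A r q) := rfl

theorem hasDerivAt_matrix_mul_apply {l m n : Type*} [Fintype m] {A : ℝ → Matrix l m ℝ}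
    {B : ℝ → Matrix m n ℝ} {A' : Matrix l m ℝ} {B' : Matrix m n ℝ} {t : ℝ}
    (hA : ∀ i j, HasDerivAt (fun s => A s i j) (A' i j) t)
    (hB : ∀ i j, HasDerivAt (fun s => B s i j) (B' i j) t) (i : l) (j : n) :
    HasDerivAt (fun s => (A s * B s) i j) ((A' * B t + A t * B') i j) t := by
  simp only [Matrix.mul_apply, Matrix.add_apply, ← Finset.sum_add_distrib]
  exact HasDerivAt.fun_sum fun r _ => (hA i r).mul (hB r j)

namespace IsAdaptedBasis

variable {k : ℕ} {ε kt ν lam : ℕ → ℝ} {x : ℕ → Fin (2 * k) → ℝ}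

theorem mem_Icc (i : Fin k) : (i : ℕ) + 1 ∈ Set.Icc 1 k := ⟨by omega, by omega⟩

theorem columnMatrix_zero (i : Fin k) :
    (fun r => columnMatrix k ε kt lam x r (0, i)) = x (i + 1) := by
  ext r; simp [columnMatrix]

theorem columnMatrix_one (i : Fin k) :
    (fun r => columnMatrix k ε kt lam x r (1, i)) =
      (lam (i + 1))⁻¹ • (shapeMatrix (2 * k) ε kt *ᵥ x (i + 1)) := by
  ext r; simp [columnMatrix]

/-- This sign separates the hyperbolic first plane from the circular remaining ones. -/
theorem eigenvalue_div (h : IsAdaptedBasis k ε kt ν lam x) (i : Fin k) :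
    ν (i + 1) / lam (i + 1) = if (i : ℕ) = 0 then lam (i + 1) else -lam (i + 1) := by
  have hl := h.lam_ne _ (mem_Icc i)
  split_ifs with hi
  · rw [hi, zero_add, h.first]
    rw [hi, zero_add] at hl
    field_simp
  · rw [h.later _ ⟨by omega, by omega⟩]
    field_simp

/-- Parity kills the products of `xᵢ` with `M xⱼ`, and skew-adjointness turns those of `M xᵢ` with
`M xⱼ` into `-νⱼ (xᵢ · xⱼ)`. Dividing by `λᵢ²` gives `-ε₁` in the first plane and `1` in the others.
-/
theorem gram_columnMatrix (h : IsAdaptedBasis k ε kt ν lam x) :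
    (columnMatrix k ε kt lam x)ᵀ * (signMatrix (2 * k) ε * columnMatrix k ε kt lam x) =
      blockDiagonal fun i : Fin k => pairGram (ε 1) i := by
  ext ⟨p, i⟩ ⟨q, j⟩
  rw [transpose_mul_mul_apply, blockDiagonal_apply]
  have hpar : ∀ i : Fin k, parityMatrix (2 * k) *ᵥ
      ((lam (i + 1))⁻¹ • (shapeMatrix (2 * k) ε kt *ᵥ x (i + 1))) =
        -((lam (i + 1))⁻¹ • (shapeMatrix (2 * k) ε kt *ᵥ x (i + 1))) := by
    intro i
    rw [mulVec_smul, parity_shapeMatrix_mulVec (h.parity _ (mem_Icc i)), smul_neg]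
  have hij : (i : ℕ) + 1 = j + 1 ↔ i = j := by rw [Fin.ext_iff]; omega
  have hi1 : (i : ℕ) + 1 = 1 ↔ (i : ℕ) = 0 := by omega
  fin_cases p <;> fin_cases q <;> simp only [Fin.zero_eta, Fin.mk_one, columnMatrix_zero,
    columnMatrix_one]
  · rw [h.gram _ (mem_Icc i) _ (mem_Icc j)]
    simp only [hij, hi1, pairGram]
    by_cases e : i = j
    · subst e; by_cases e' : (i : ℕ) = 0 <;> simp [e']
    · simp [e]
  · rw [form_eq_zero_of_parity (h.parity _ (mem_Icc i)) (hpar j)]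
    by_cases e' : (i : ℕ) = 0 <;> simp [pairGram, e']
  · rw [signMatrix, diagonal_form_comm, ← signMatrix,
      form_eq_zero_of_parity (h.parity _ (mem_Icc j)) (hpar i)]
    by_cases e' : (i : ℕ) = 0 <;> simp [pairGram, e']
  · rw [smul_dotProduct, mulVec_smul, dotProduct_smul, form_shapeMatrix_left,
      h.eigen _ (mem_Icc j), mulVec_smul, dotProduct_smul, h.gram _ (mem_Icc i) _ (mem_Icc j)]
    simp only [hij, hi1, smul_eq_mul]
    by_cases e : i = j
    · subst e
      have hd := h.eigenvalue_div i
      have hl := h.lam_ne _ (mem_Icc i)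
      rw [div_eq_iff hl] at hd
      rw [hd]
      by_cases e' : (i : ℕ) = 0
      · simp only [if_pos e', pairGram, if_true, diagonal_apply_eq, cons_val_one, cons_val_zero]
        field_simp
      · simp only [if_neg e', pairGram, if_true, one_apply_eq]
        field_simp
    · simp [e]

theorem shapeMatrix_mul_columnMatrix (h : IsAdaptedBasis k ε kt ν lam x) :
    shapeMatrix (2 * k) ε kt * columnMatrix k ε kt lam x =
      columnMatrix k ε kt lam x * blockDiagonal fun i : Fin k => pairGenerator ν lam i := by
  ext r ⟨q, j⟩
  have hl := h.lam_ne _ (mem_Icc j)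
  have hleft : (shapeMatrix (2 * k) ε kt * columnMatrix k ε kt lam x) r (q, j) =
      (shapeMatrix (2 * k) ε kt *ᵥ fun s => columnMatrix k ε kt lam x s (q, j)) r := rfl
  rw [hleft, mul_apply, Fintype.sum_prod_type, Fin.sum_univ_two]
  simp only [blockDiagonal_apply, mul_ite, mul_zero, Finset.sum_ite_eq', Finset.mem_univ, if_true]
  fin_cases q
  · simp only [Fin.zero_eta, columnMatrix_zero]
    simp [pairGenerator, columnMatrix]
    field_simp
  · simp only [Fin.mk_one, columnMatrix_one, mulVec_smul, h.eigen _ (mem_Icc j)]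
    simp [pairGenerator, columnMatrix]
    field_simp

/-- The Gram matrix of the columns is invertible, hence so is the matrix of columns. -/
theorem det_columnMatrix_ne_zero (h : IsAdaptedBasis k ε kt ν lam x) :
    ((columnMatrix k ε kt lam x).submatrix id (parityEquiv k)).det ≠ 0 := by
  have h1 := congrArg (fun A => (A.submatrix (parityEquiv k) (parityEquiv k)).det)
    h.gram_columnMatrix
  simp only [det_submatrix_equiv_self, det_blockDiagonal] at h1
  have h2 : ∏ i : Fin k, (pairGram (ε 1) i).det ≠ 0 := by
    refine Finset.prod_ne_zero_iff.2 fun i _ => ?_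
    have := h.sign_sq
    by_cases hi : (i : ℕ) = 0
    · simp [pairGram, hi, this]
    · simp [pairGram, hi]
  rw [← h1, ← det_submatrix_equiv_self (parityEquiv k),
    ← submatrix_mul_equiv _ _ (parityEquiv k) (Equiv.refl _) (parityEquiv k),
    ← submatrix_mul_equiv _ _ (Equiv.refl _) (Equiv.refl _) (parityEquiv k), det_mul, det_mul] at h2
  exact right_ne_zero_of_mul (right_ne_zero_of_mul h2)

end IsAdaptedBasis

/-! ### Orientation of the adapted basis. -/

namespace IsAdaptedBasis

variable {k : ℕ} {ε kt ν lam : ℕ → ℝ} {x : ℕ → Fin (2 * k) → ℝ}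

/-- Changing the sign of `λ₂` changes the orientation of the adapted basis. -/
theorem det_columnMatrix_update (hk : 2 ≤ k) :
    ((columnMatrix k ε kt (Function.update lam 2 (-lam 2)) x).submatrix id (parityEquiv k)).det =
      -((columnMatrix k ε kt lam x).submatrix id (parityEquiv k)).det := by
  have h : columnMatrix k ε kt (Function.update lam 2 (-lam 2)) x = columnMatrix k ε kt lam x *
      diagonal fun q : Fin 2 × Fin k => if q = (1, ⟨1, by omega⟩) then (-1 : ℝ) else 1 := by
    ext r ⟨p, i⟩
    rw [mul_diagonal]
    fin_cases p
    · simp [columnMatrix]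
    · by_cases hi : i = ⟨1, by omega⟩
      · subst hi; simp [columnMatrix, inv_neg]
      · have hi2 : (i : ℕ) + 1 ≠ 2 := fun h => hi (Fin.ext (by simpa using h))
        simp [columnMatrix, hi, Function.update_of_ne hi2]
  rw [h, ← submatrix_mul_equiv _ _ id (parityEquiv k) (parityEquiv k), det_mul,
    det_submatrix_equiv_self, det_diagonal, Finset.prod_ite_eq' Finset.univ _ (fun _ => (-1 : ℝ)),
    if_pos (Finset.mem_univ _), mul_neg_one]

/-- Apart from being nonzero, `λ₂` is constrained only through its square. -/
theorem update_lam (h : IsAdaptedBasis k ε kt ν lam x) :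
    IsAdaptedBasis k ε kt ν (Function.update lam 2 (-lam 2)) x where
  sign_sq := h.sign_sq
  parity := h.parity
  eigen := h.eigen
  gram := h.gram
  lam_ne i hi := by
    by_cases h2 : i = 2
    · subst h2; simpa using h.lam_ne 2 hi
    · simpa [h2] using h.lam_ne i hi
  first := by simpa using h.first
  later i hi := by
    by_cases h2 : i = 2
    · subst h2; simpa using h.later 2 hi
    · simpa [h2] using h.later i hi

/-- The orientation of the adapted basis can be prescribed if there is more than one plane, and is
determined by the signs of the frame otherwise. -/
theorem exists_det_pos (hk : 1 ≤ k) (h : IsAdaptedBasis k ε kt ν lam x) (h0 : 0 < lam 1)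
    (hx : x 1 ⟨0, by omega⟩ ≠ 0) :
    ∃ lam' : ℕ → ℝ, IsAdaptedBasis k ε kt ν lam' x ∧ 0 < lam' 1 ∧
      0 < ((columnMatrix k ε kt lam' x).submatrix id (parityEquiv k)).det *
        (-ε 1 * (-1) ^ (k - 1)) := by
  -- The factor `-ε 1 * (-1) ^ (k - 1)` is the product of the determinants of the moving plane bases
  -- used later: `-ε 1` for the first plane and `-1` for each of the others.
  have hne := h.det_columnMatrix_ne_zero
  have hε : ε 1 ≠ 0 := fun e => by have := h.sign_sq; rw [e] at this; norm_num at this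
  rcases Nat.lt_or_ge k 2 with hk2 | hk2
  · obtain rfl : k = 1 := by omega
    refine ⟨lam, h, h0, ?_⟩
    -- With a single plane there is no sign left to choose, as `λ₁` must stay positive; but the
    -- determinant is `-ε₁ x² / λ₁`, with `x` the first coordinate, and has the required sign.
    have hx1 : x 1 (1 : Fin 2) = 0 :=
      apply_eq_zero_of_parity (k := 1) (i := (1 : Fin 2)) (h.parity 1 ⟨le_rfl, le_rfl⟩) (by simp)
    have hN : (shapeMatrix (2 * 1) ε kt *ᵥ x 1) (1 : Fin 2) = -ε 1 * x 1 (0 : Fin 2) := by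
      rw [shapeMatrix_mulVec_row]
      simp [curvRatio, extendOne]
    have hdet : ((columnMatrix 1 ε kt lam x).submatrix id (parityEquiv 1)).det =
        x 1 (0 : Fin 2) * ((lam 1)⁻¹ * (-ε 1 * x 1 (0 : Fin 2))) := by
      rw [← hN]
      refine (det_fin_two _).trans ?_
      simp [columnMatrix, parityEquiv, hx1]
    rw [hdet]
    have : x 1 (0 : Fin 2) * ((lam 1)⁻¹ * (-ε 1 * x 1 (0 : Fin 2))) * (-ε 1 * (-1) ^ (1 - 1)) =
        (lam 1)⁻¹ * (x 1 (0 : Fin 2) * x 1 (0 : Fin 2)) * (ε 1 * ε 1) := by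
      simp; ring
    rw [this, h.sign_sq, mul_one]
    exact mul_pos (inv_pos.2 h0) (mul_self_pos.2 hx)
  · have hfac : -ε 1 * (-1) ^ (k - 1) ≠ 0 :=
      mul_ne_zero (neg_ne_zero.2 hε) (pow_ne_zero _ (by norm_num))
    rcases lt_or_gt_of_ne (mul_ne_zero hne hfac) with hlt | hgt
    · refine ⟨_, h.update_lam, by simpa using h0, ?_⟩
      rw [det_columnMatrix_update hk2]
      linarith
    · exact ⟨lam, h, h0, hgt⟩

end IsAdaptedBasis

/-! ### Solutions of the frame equations built plane by plane. -/

/-- The frame assembled from an adapted basis and moving bases of its planes. -/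
noncomputable def modelFrame (k : ℕ) (ε kt lam : ℕ → ℝ) (x : ℕ → Fin (2 * k) → ℝ)
    (R : ℕ → ℝ → Matrix (Fin 2) (Fin 2) ℝ) (σ : ℝ) : Matrix (Fin (2 * k)) (Fin (2 * k)) ℝ :=
  (columnMatrix k ε kt lam x * blockDiagonal fun i : Fin k => R i σ).submatrix id (parityEquiv k)

section ModelFrame

variable {k : ℕ} {ε kt ν lam : ℕ → ℝ} {x : ℕ → Fin (2 * k) → ℝ}
  {R : ℕ → ℝ → Matrix (Fin 2) (Fin 2) ℝ}

theorem hasDerivAt_modelFrame (h : IsAdaptedBasis k ε kt ν lam x) {σ : ℝ}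
    (hR : ∀ i < k, ∀ p q, HasDerivAt (fun s => R i s p q) ((pairGenerator ν lam i * R i σ) p q) σ)
    (i j : Fin (2 * k)) :
    HasDerivAt (fun s => modelFrame k ε kt lam x R s i j)
      ((shapeMatrix (2 * k) ε kt * modelFrame k ε kt lam x R σ) i j) σ := by
  have hX : ∀ r q, HasDerivAt (fun _ : ℝ => columnMatrix k ε kt lam x r q)
      ((0 : Matrix (Fin (2 * k)) (Fin 2 × Fin k) ℝ) r q) σ := fun r q => hasDerivAt_const _ _
  have hB : ∀ q q', HasDerivAt (fun s => (blockDiagonal fun i : Fin k => R i s) q q')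
      ((blockDiagonal fun i : Fin k => pairGenerator ν lam i * R i σ) q q') σ := by
    rintro ⟨p, i⟩ ⟨q, j⟩
    simp only [blockDiagonal_apply]
    split_ifs
    · exact hR i i.2 p q
    · exact hasDerivAt_const _ _
  have := hasDerivAt_matrix_mul_apply hX hB i (parityEquiv k j)
  rw [Matrix.zero_mul, zero_add, blockDiagonal_mul, ← Matrix.mul_assoc,
    ← h.shapeMatrix_mul_columnMatrix, Matrix.mul_assoc] at this
  exact this

/-- The target has `-1` where the adapted basis has `ε 1`: in the spacelike case the first block
must carry `diag(1, -1)` to `diag(-1, 1)`, moving the timelike direction to the first coordinate. -/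
theorem gram_modelFrame (h : IsAdaptedBasis k ε kt ν lam x) {σ : ℝ}
    (hR : ∀ i < k, (R i σ)ᵀ * (pairGram (ε 1) i * R i σ) = pairGram (-1) i) :
    (modelFrame k ε kt lam x R σ)ᵀ * (signMatrix (2 * k) ε * modelFrame k ε kt lam x R σ) =
      minkMatrix (2 * k) := by
  have h1 : (columnMatrix k ε kt lam x * blockDiagonal fun i : Fin k => R i σ)ᵀ *
      (signMatrix (2 * k) ε * (columnMatrix k ε kt lam x * blockDiagonal fun i : Fin k => R i σ)) =
      blockDiagonal fun i : Fin k => pairGram (-1) i := by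
    rw [transpose_mul, ← Matrix.mul_assoc (signMatrix _ _), Matrix.mul_assoc,
      ← Matrix.mul_assoc _ _ (blockDiagonal _), h.gram_columnMatrix, blockDiagonal_transpose,
      ← blockDiagonal_mul, ← blockDiagonal_mul]
    congr 1
    ext1 i
    exact hR i i.2
  ext i j
  have h2 := congrFun (congrFun h1 (parityEquiv k i)) (parityEquiv k j)
  refine Eq.trans h2 ?_
  rw [blockDiagonal_apply, minkMatrix, diagonal_apply]
  by_cases hij : i = j
  · subst hij
    rw [if_pos rfl, if_pos rfl]
    by_cases h0 : (i : ℕ) / 2 = 0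
    · have : (i : ℕ) = 0 ∨ (i : ℕ) = 1 := by omega
      rcases this with h' | h' <;> simp [pairGram, parityEquiv, h']
    · have : (i : ℕ) ≠ 0 := by omega
      have h0' : ((parityEquiv k i).2 : ℕ) ≠ 0 := h0
      rw [pairGram, if_neg h0', if_neg this, one_apply_eq]
  · rw [if_neg hij]
    split_ifs with h'
    · have hne : (parityEquiv k i).1 ≠ (parityEquiv k j).1 := fun e =>
        hij ((parityEquiv k).injective (Prod.ext e h'))
      simp only [pairGram]
      split_ifs
      · exact diagonal_apply_ne _ hne
      · exact one_apply_ne hne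
    · rfl

theorem det_modelFrame (σ : ℝ) :
    (modelFrame k ε kt lam x R σ).det =
      ((columnMatrix k ε kt lam x).submatrix id (parityEquiv k)).det *
        ∏ i : Fin k, (R i σ).det := by
  rw [modelFrame, ← submatrix_mul_equiv _ _ id (parityEquiv k) (parityEquiv k), det_mul,
    det_submatrix_equiv_self, det_blockDiagonal]

/-- The columns `λᵢ⁻¹ M xᵢ` are odd and contribute nothing to the first row. The first coordinate of
`xᵢ` is left as the amplitude `aᵢ`. -/
theorem modelFrame_first_row (hk : 1 ≤ k) (h : IsAdaptedBasis k ε kt ν lam x) (σ : ℝ)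
    (j : Fin (2 * k)) :
    modelFrame k ε kt lam x R σ ⟨0, by omega⟩ j =
      x (j / 2 + 1) ⟨0, by omega⟩ * R (j / 2) σ 0 (parityEquiv k j).1 := by
  have hq : ∀ i : Fin k, columnMatrix k ε kt lam x ⟨0, by omega⟩ (1, i) = 0 := by
    intro i
    have := apply_eq_zero_of_parity_neg (i := (⟨0, by omega⟩ : Fin (2 * k)))
      (parity_shapeMatrix_mulVec (kt := kt) (ε := ε)
        (h.parity _ (IsAdaptedBasis.mem_Icc i))) (by simp)
    simp [columnMatrix, this]
  rw [modelFrame, submatrix_apply, mul_apply, Fintype.sum_prod_type, Fin.sum_univ_two]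
  simp only [id, hq, zero_mul, add_zero, blockDiagonal_apply, mul_ite,
    mul_zero, Finset.sum_ite_eq', Finset.mem_univ, if_true]
  rfl

end ModelFrame

/-! ### Explicit rotations and boosts of the planes. -/

/-- The direction `(C, S)` of the derivative of `e^{κ̃₁ σ} (sin θᵢ, -cos θᵢ)`. -/
noncomputable def circularPair (kt₁ : ℝ) (lam : ℕ → ℝ) (i : ℕ) (σ : ℝ) :
    Matrix (Fin 2) (Fin 2) ℝ :=
  (bCoeff kt₁ lam i)⁻¹ •
    !![kt₁ * Real.sin (thetaAngle kt₁ lam i σ) + lam i * Real.cos (thetaAngle kt₁ lam i σ),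
      lam i * Real.sin (thetaAngle kt₁ lam i σ) - kt₁ * Real.cos (thetaAngle kt₁ lam i σ);
      lam i * Real.sin (thetaAngle kt₁ lam i σ) - kt₁ * Real.cos (thetaAngle kt₁ lam i σ),
      -(kt₁ * Real.sin (thetaAngle kt₁ lam i σ) + lam i * Real.cos (thetaAngle kt₁ lam i σ))]

/-- The moving bases of the planes belonging to the timelike model. -/
noncomputable def timelikePair (kt₁ : ℝ) (lam : ℕ → ℝ) (i : ℕ) (σ : ℝ) :
    Matrix (Fin 2) (Fin 2) ℝ :=
  if i = 0 then (bCoeff kt₁ lam 1)⁻¹ •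
    !![kt₁ * Real.sinh (thetaAngle kt₁ lam 1 σ) + lam 1 * Real.cosh (thetaAngle kt₁ lam 1 σ),
      kt₁ * Real.cosh (thetaAngle kt₁ lam 1 σ) + lam 1 * Real.sinh (thetaAngle kt₁ lam 1 σ);
      kt₁ * Real.cosh (thetaAngle kt₁ lam 1 σ) + lam 1 * Real.sinh (thetaAngle kt₁ lam 1 σ),
      kt₁ * Real.sinh (thetaAngle kt₁ lam 1 σ) + lam 1 * Real.cosh (thetaAngle kt₁ lam 1 σ)]
  else circularPair kt₁ lam (i + 1) σ

/-- The moving bases of the planes belonging to the spacelike model. -/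
noncomputable def spacelikePair (kt₁ : ℝ) (lam : ℕ → ℝ) (i : ℕ) (σ : ℝ) :
    Matrix (Fin 2) (Fin 2) ℝ :=
  if i = 0 then -((bCoeff kt₁ lam 1)⁻¹ •
    !![kt₁ * Real.cosh (thetaAngle kt₁ lam 1 σ) + lam 1 * Real.sinh (thetaAngle kt₁ lam 1 σ),
      kt₁ * Real.sinh (thetaAngle kt₁ lam 1 σ) + lam 1 * Real.cosh (thetaAngle kt₁ lam 1 σ);
      kt₁ * Real.sinh (thetaAngle kt₁ lam 1 σ) + lam 1 * Real.cosh (thetaAngle kt₁ lam 1 σ),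
      kt₁ * Real.cosh (thetaAngle kt₁ lam 1 σ) + lam 1 * Real.sinh (thetaAngle kt₁ lam 1 σ)])
  else circularPair kt₁ lam (i + 1) σ

section Pairs

variable {kt₁ : ℝ} {lam ν : ℕ → ℝ}

/-- Only the slope of `θᵢ` matters below: another phase would merely rotate or boost a coordinate
plane. -/
theorem hasDerivAt_thetaAngle (kt₁ : ℝ) (lam : ℕ → ℝ) (i : ℕ) (σ : ℝ) :
    HasDerivAt (thetaAngle kt₁ lam i) (lam i) σ := by
  by_cases hi : i = 1
  · subst hi
    have : thetaAngle kt₁ lam 1 =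
        fun s => lam 1 * s - Real.arcosh (lam 1 / bCoeff kt₁ lam 1) := by
      ext s; simp [thetaAngle]
    rw [this]
    simpa using ((hasDerivAt_id σ).const_mul (lam 1)).sub_const
      (Real.arcosh (lam 1 / bCoeff kt₁ lam 1))
  · have : thetaAngle kt₁ lam i =
        fun s => lam i * s + Real.arccos (lam i / bCoeff kt₁ lam i) := by
      ext s; simp [thetaAngle, hi]
    rw [this]
    simpa using ((hasDerivAt_id σ).const_mul (lam i)).add_const
      (Real.arccos (lam i / bCoeff kt₁ lam i))

theorem bCoeff_one_sq (h : kt₁ ^ 2 < lam 1 ^ 2) :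
    bCoeff kt₁ lam 1 ^ 2 = lam 1 ^ 2 - kt₁ ^ 2 := by
  rw [bCoeff, if_pos rfl, Real.sq_sqrt (by linarith)]

theorem bCoeff_one_ne_zero (h : kt₁ ^ 2 < lam 1 ^ 2) : bCoeff kt₁ lam 1 ≠ 0 := by
  intro h0
  have := bCoeff_one_sq h
  rw [h0] at this
  linarith

theorem bCoeff_sq {i : ℕ} (hi : i ≠ 1) : bCoeff kt₁ lam i ^ 2 = lam i ^ 2 + kt₁ ^ 2 := by
  rw [bCoeff, if_neg hi, Real.sq_sqrt (by positivity)]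

theorem bCoeff_ne_zero {i : ℕ} (hi : i ≠ 1) (hl : lam i ≠ 0) : bCoeff kt₁ lam i ≠ 0 := by
  intro h0
  have := bCoeff_sq (kt₁ := kt₁) (lam := lam) hi
  rw [h0] at this
  have := pow_pos (abs_pos.2 hl) 2
  rw [sq_abs] at this
  nlinarith [sq_nonneg kt₁]

/-- The entries satisfy `C' = -λ S` and `S' = λ C`, so the rows `(C, S)` and `(S, -C)` solve the
block system. -/
theorem hasDerivAt_circularPair (kt₁ : ℝ) {i : ℕ} (hl : lam (i + 1) ≠ 0)
    (hν : ν (i + 1) = -lam (i + 1) ^ 2) (σ : ℝ) (p q : Fin 2) :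
    HasDerivAt (fun s => circularPair kt₁ lam (i + 1) s p q)
      ((pairGenerator ν lam i * circularPair kt₁ lam (i + 1) σ) p q) σ := by
  have hθ := hasDerivAt_thetaAngle kt₁ lam (i + 1) σ
  have hL : ν (i + 1) / lam (i + 1) = -lam (i + 1) := by rw [hν]; field_simp
  have h1 := (((hθ.sin.const_mul kt₁).add (hθ.cos.const_mul (lam (i + 1)))).const_mul
    (bCoeff kt₁ lam (i + 1))⁻¹)
  have h2 := (((hθ.sin.const_mul (lam (i + 1))).sub (hθ.cos.const_mul kt₁)).const_mul
    (bCoeff kt₁ lam (i + 1))⁻¹)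
  have h3 := (((hθ.sin.const_mul kt₁).add (hθ.cos.const_mul (lam (i + 1)))).neg.const_mul
    (bCoeff kt₁ lam (i + 1))⁻¹)
  fin_cases p <;> fin_cases q
  · refine h1.congr_deriv ?_
    simp [pairGenerator, circularPair, mul_apply, hL]; ring
  · refine h2.congr_deriv ?_
    simp [pairGenerator, circularPair, mul_apply, hL]; ring
  · refine h2.congr_deriv ?_
    simp [pairGenerator, circularPair, mul_apply]; ring
  · refine h3.congr_deriv ?_
    simp [pairGenerator, circularPair, mul_apply]; ring

/-- `bᵢ` is the normalisation giving `C² + S² = 1`. -/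
theorem gram_circularPair {i : ℕ} (hi : i ≠ 1) (hl : lam i ≠ 0) (σ : ℝ) :
    (circularPair kt₁ lam i σ)ᵀ * circularPair kt₁ lam i σ = 1 := by
  have hb := bCoeff_ne_zero (kt₁ := kt₁) hi hl
  have hb2 := bCoeff_sq (kt₁ := kt₁) (lam := lam) hi
  have hsc := Real.sin_sq_add_cos_sq (thetaAngle kt₁ lam i σ)
  ext p q
  fin_cases p <;> fin_cases q <;> simp [circularPair, mul_apply] <;> field_simp
  · rw [hb2]; linear_combination (lam i ^ 2 + kt₁ ^ 2) * hsc
  · ring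
  · ring
  · rw [hb2]; linear_combination (lam i ^ 2 + kt₁ ^ 2) * hsc

theorem det_circularPair {i : ℕ} (hi : i ≠ 1) (hl : lam i ≠ 0) (σ : ℝ) :
    (circularPair kt₁ lam i σ).det = -1 := by
  have hb := bCoeff_ne_zero (kt₁ := kt₁) hi hl
  have hb2 := bCoeff_sq (kt₁ := kt₁) (lam := lam) hi
  have hsc := Real.sin_sq_add_cos_sq (thetaAngle kt₁ lam i σ)
  simp [circularPair, det_fin_two]
  field_simp
  rw [hb2]
  linear_combination (-(lam i ^ 2 + kt₁ ^ 2)) * hsc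

theorem hasDerivAt_timelikePair_zero (h1 : ν 1 = lam 1 ^ 2) (h0 : lam 1 ≠ 0) (σ : ℝ)
    (p q : Fin 2) :
    HasDerivAt (fun s => timelikePair kt₁ lam 0 s p q)
      ((pairGenerator ν lam 0 * timelikePair kt₁ lam 0 σ) p q) σ := by
  have hθ := hasDerivAt_thetaAngle kt₁ lam 1 σ
  have hL : ν 1 / lam 1 = lam 1 := by rw [h1]; field_simp
  have hC := (((hθ.sinh.const_mul kt₁).add (hθ.cosh.const_mul (lam 1))).const_mul
    (bCoeff kt₁ lam 1)⁻¹)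
  have hS := (((hθ.cosh.const_mul kt₁).add (hθ.sinh.const_mul (lam 1))).const_mul
    (bCoeff kt₁ lam 1)⁻¹)
  fin_cases p <;> fin_cases q
  · refine hC.congr_deriv ?_
    simp [pairGenerator, timelikePair, mul_apply, hL]; ring
  · refine hS.congr_deriv ?_
    simp [pairGenerator, timelikePair, mul_apply, hL]; ring
  · refine hS.congr_deriv ?_
    simp [pairGenerator, timelikePair, mul_apply]; ring
  · refine hC.congr_deriv ?_
    simp [pairGenerator, timelikePair, mul_apply]; ring

theorem hasDerivAt_spacelikePair_zero (h1 : ν 1 = lam 1 ^ 2) (h0 : lam 1 ≠ 0) (σ : ℝ)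
    (p q : Fin 2) :
    HasDerivAt (fun s => spacelikePair kt₁ lam 0 s p q)
      ((pairGenerator ν lam 0 * spacelikePair kt₁ lam 0 σ) p q) σ := by
  have hθ := hasDerivAt_thetaAngle kt₁ lam 1 σ
  have hL : ν 1 / lam 1 = lam 1 := by rw [h1]; field_simp
  have hC := (((hθ.sinh.const_mul kt₁).add (hθ.cosh.const_mul (lam 1))).const_mul
    (bCoeff kt₁ lam 1)⁻¹).neg
  have hS := (((hθ.cosh.const_mul kt₁).add (hθ.sinh.const_mul (lam 1))).const_mul
    (bCoeff kt₁ lam 1)⁻¹).neg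
  fin_cases p <;> fin_cases q
  · refine hS.congr_deriv ?_
    simp [pairGenerator, spacelikePair, mul_apply, hL]; ring
  · refine hC.congr_deriv ?_
    simp [pairGenerator, spacelikePair, mul_apply, hL]; ring
  · refine hC.congr_deriv ?_
    simp [pairGenerator, spacelikePair, mul_apply]; ring
  · refine hS.congr_deriv ?_
    simp [pairGenerator, spacelikePair, mul_apply]; ring

theorem gram_timelikePair_zero (h : kt₁ ^ 2 < lam 1 ^ 2) (σ : ℝ) :
    (timelikePair kt₁ lam 0 σ)ᵀ * (pairGram (-1) 0 * timelikePair kt₁ lam 0 σ) =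
      pairGram (-1) 0 := by
  have hb := bCoeff_one_ne_zero h
  have hb2 := bCoeff_one_sq h
  have hsc := Real.cosh_sq_sub_sinh_sq (thetaAngle kt₁ lam 1 σ)
  ext p q
  fin_cases p <;> fin_cases q <;> simp [timelikePair, pairGram, mul_apply] <;> field_simp
  · rw [hb2]; linear_combination (-(lam 1 ^ 2 - kt₁ ^ 2)) * hsc
  · ring
  · ring
  · rw [hb2]; linear_combination (lam 1 ^ 2 - kt₁ ^ 2) * hsc

/-- Up to sign this is the timelike block with its rows exchanged, which exchanges the roles of the
two signs; hence `1` on the left and `-1` on the right. -/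
theorem gram_spacelikePair_zero (h : kt₁ ^ 2 < lam 1 ^ 2) (σ : ℝ) :
    (spacelikePair kt₁ lam 0 σ)ᵀ * (pairGram 1 0 * spacelikePair kt₁ lam 0 σ) =
      pairGram (-1) 0 := by
  have hb := bCoeff_one_ne_zero h
  have hb2 := bCoeff_one_sq h
  have hsc := Real.cosh_sq_sub_sinh_sq (thetaAngle kt₁ lam 1 σ)
  ext p q
  fin_cases p <;> fin_cases q <;> simp [spacelikePair, pairGram, mul_apply] <;> field_simp
  · rw [hb2]; linear_combination (-(lam 1 ^ 2 - kt₁ ^ 2)) * hsc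
  · ring
  · ring
  · rw [hb2]; linear_combination (lam 1 ^ 2 - kt₁ ^ 2) * hsc

theorem det_timelikePair_zero (h : kt₁ ^ 2 < lam 1 ^ 2) (σ : ℝ) :
    (timelikePair kt₁ lam 0 σ).det = 1 := by
  have hb := bCoeff_one_ne_zero h
  have hb2 := bCoeff_one_sq h
  have hsc := Real.cosh_sq_sub_sinh_sq (thetaAngle kt₁ lam 1 σ)
  simp [timelikePair, det_fin_two]
  field_simp
  rw [hb2]
  linear_combination (lam 1 ^ 2 - kt₁ ^ 2) * hsc

theorem det_spacelikePair_zero (h : kt₁ ^ 2 < lam 1 ^ 2) (σ : ℝ) :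
    (spacelikePair kt₁ lam 0 σ).det = -1 := by
  have hb := bCoeff_one_ne_zero h
  have hb2 := bCoeff_one_sq h
  have hsc := Real.cosh_sq_sub_sinh_sq (thetaAngle kt₁ lam 1 σ)
  simp [spacelikePair, det_fin_two]
  field_simp
  rw [hb2]
  linear_combination (-(lam 1 ^ 2 - kt₁ ^ 2)) * hsc

end Pairs

/-! ### The explicit curves as integrals of the first frame vector. -/

section Models

variable {k : ℕ} {ε kt ν lam : ℕ → ℝ} {x : ℕ → Fin (2 * k) → ℝ}

/-- Differentiating `e^{κ̃₁ σ} sin θ` produces `κ̃₁ sin θ + λ cos θ`, the combination from which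
`circularPair` is built. -/
theorem hasDerivAt_circular_sin (kt₁ : ℝ) (lam a : ℕ → ℝ) (i : ℕ) (σ : ℝ) :
    HasDerivAt (fun s => amplitude kt₁ lam a i s * Real.sin (thetaAngle kt₁ lam i s))
      (Real.exp (kt₁ * σ) * (a i * circularPair kt₁ lam i σ 0 0)) σ := by
  have hθ := hasDerivAt_thetaAngle kt₁ lam i σ
  have hA := ((((hasDerivAt_id σ).const_mul kt₁).exp).const_mul (a i / bCoeff kt₁ lam i))
  refine (hA.mul hθ.sin).congr_deriv ?_
  simp [circularPair]; ring

theorem hasDerivAt_circular_cos (kt₁ : ℝ) (lam a : ℕ → ℝ) (i : ℕ) (σ : ℝ) :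
    HasDerivAt (fun s => -(amplitude kt₁ lam a i s * Real.cos (thetaAngle kt₁ lam i s)))
      (Real.exp (kt₁ * σ) * (a i * circularPair kt₁ lam i σ 0 1)) σ := by
  have hθ := hasDerivAt_thetaAngle kt₁ lam i σ
  have hA := ((((hasDerivAt_id σ).const_mul kt₁).exp).const_mul (a i / bCoeff kt₁ lam i))
  refine (hA.mul hθ.cos).neg.congr_deriv ?_
  simp [circularPair]; ring

theorem parityEquiv_fst_of_even {j : Fin (2 * k)} (h : (j : ℕ) % 2 = 0) :
    (parityEquiv k j).1 = 0 := Fin.ext h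

theorem parityEquiv_fst_of_odd {j : Fin (2 * k)} (h : (j : ℕ) % 2 ≠ 0) :
    (parityEquiv k j).1 = 1 := Fin.ext (Nat.mod_two_ne_zero.1 h)

theorem hasDerivAt_timelikeModel (hk : 1 ≤ k) (h : IsAdaptedBasis k ε kt ν lam x) (kt₁ σ : ℝ) :
    HasDerivAt (timelikeModel k kt₁ lam fun i => x i ⟨0, by omega⟩)
      (Real.exp (kt₁ * σ) •
        modelFrame k ε kt lam x (timelikePair kt₁ lam) σ ⟨0, by omega⟩) σ := by
  rw [hasDerivAt_pi]
  intro j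
  rw [Pi.smul_apply, modelFrame_first_row hk h, smul_eq_mul]
  set a : ℕ → ℝ := fun i => x i ⟨0, by omega⟩ with ha
  have hθ := hasDerivAt_thetaAngle kt₁ lam 1 σ
  have hA := ((((hasDerivAt_id σ).const_mul kt₁).exp).const_mul (a 1 / bCoeff kt₁ lam 1))
  by_cases h0 : (j : ℕ) = 0
  · simp only [timelikeModel, h0, if_true]
    rw [parityEquiv_fst_of_even (by omega)]
    refine (hA.mul hθ.sinh).congr_deriv ?_
    simp [timelikePair, ha]; ring
  by_cases h1 : (j : ℕ) = 1
  · simp only [timelikeModel, h1, one_ne_zero, if_true, if_false]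
    rw [parityEquiv_fst_of_odd (by omega)]
    refine (hA.mul hθ.cosh).congr_deriv ?_
    simp [timelikePair, ha]; ring
  have h2 : (j : ℕ) / 2 ≠ 0 := by omega
  by_cases he : (j : ℕ) % 2 = 0
  · simp only [timelikeModel, h0, h1, he, if_true, if_false, timelikePair, h2]
    rw [parityEquiv_fst_of_even he]
    exact hasDerivAt_circular_sin kt₁ lam a _ σ
  · simp only [timelikeModel, h0, h1, he, if_false, timelikePair, h2]
    rw [parityEquiv_fst_of_odd he]
    exact hasDerivAt_circular_cos kt₁ lam a _ σ

theorem hasDerivAt_spacelikeModel (hk : 1 ≤ k) (h : IsAdaptedBasis k ε kt ν lam x) (kt₁ σ : ℝ) :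
    HasDerivAt (spacelikeModel k kt₁ lam fun i => x i ⟨0, by omega⟩)
      (Real.exp (kt₁ * σ) •
        modelFrame k ε kt lam x (spacelikePair kt₁ lam) σ ⟨0, by omega⟩) σ := by
  rw [hasDerivAt_pi]
  intro j
  rw [Pi.smul_apply, modelFrame_first_row hk h, smul_eq_mul]
  set a : ℕ → ℝ := fun i => x i ⟨0, by omega⟩ with ha
  have hθ := hasDerivAt_thetaAngle kt₁ lam 1 σ
  have hA := ((((hasDerivAt_id σ).const_mul kt₁).exp).const_mul (a 1 / bCoeff kt₁ lam 1))
  by_cases h0 : (j : ℕ) = 0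
  · simp only [spacelikeModel, h0, if_true]
    rw [parityEquiv_fst_of_even (by omega)]
    refine (hA.mul hθ.cosh).neg.congr_deriv ?_
    simp [spacelikePair, ha]; ring
  by_cases h1 : (j : ℕ) = 1
  · simp only [spacelikeModel, h1, one_ne_zero, if_true, if_false]
    rw [parityEquiv_fst_of_odd (by omega)]
    refine (hA.mul hθ.sinh).neg.congr_deriv ?_
    simp [spacelikePair, ha]; ring
  have h2 : (j : ℕ) / 2 ≠ 0 := by omega
  by_cases he : (j : ℕ) % 2 = 0
  · simp only [spacelikeModel, h0, h1, he, if_true, if_false, spacelikePair, h2]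
    rw [parityEquiv_fst_of_even he]
    exact hasDerivAt_circular_sin kt₁ lam a _ σ
  · simp only [spacelikeModel, h0, h1, he, if_false, spacelikePair, h2]
    rw [parityEquiv_fst_of_odd he]
    exact hasDerivAt_circular_cos kt₁ lam a _ σ

end Models

/-! ### Congruence of frames and uniqueness of the recursively computed frame. -/

section Congruence

variable {n : ℕ} {I : Set ℝ} {ε kt : ℕ → ℝ}

theorem minkMatrix_mul_self (n : ℕ) : minkMatrix n * minkMatrix n = 1 := by
  rw [minkMatrix, diagonal_mul_diagonal, ← diagonal_one]
  congr 1
  ext i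
  split_ifs <;> norm_num

/-- The Gram relations of the rows and those of the columns of a pseudo-orthonormal frame are
equivalent. -/
theorem gram_rows_iff_columns {E J T : Matrix (Fin n) (Fin n) ℝ} (hJ : J * J = 1) (hT : T * T = 1) :
    E * (J * Eᵀ) = T ↔ Eᵀ * (T * E) = J := by
  constructor
  · intro h
    have h1 : E * (J * Eᵀ * T) = 1 := by rw [← Matrix.mul_assoc, h, hT]
    have h2 := mul_eq_one_comm.1 h1
    calc Eᵀ * (T * E) = J * (J * Eᵀ * T * E) := by
          simp only [← Matrix.mul_assoc, hJ, Matrix.one_mul]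
      _ = J := by rw [h2, Matrix.mul_one]
  · intro h
    have h1 : Eᵀ * (T * E * J) = 1 := by
      rw [← Matrix.mul_assoc, ← Matrix.mul_assoc, Matrix.mul_assoc Eᵀ, h, hJ]
    have h2 := mul_eq_one_comm.1 h1
    calc E * (J * Eᵀ) = T * (T * E * J * Eᵀ) := by
          simp only [← Matrix.mul_assoc, hT, Matrix.one_mul]
      _ = T := by rw [h2, Matrix.mul_one]

/-- Two pseudo-orthonormal frames with the same frame equations are congruent. -/
theorem exists_isPseudoOrthogonal (hI : IsOpen I) (hI' : IsPreconnected I) (hne : I.Nonempty)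
    (hT : signMatrix n ε * signMatrix n ε = 1) {E F : ℝ → Matrix (Fin n) (Fin n) ℝ}
    (hE : ∀ σ ∈ I, ∀ i j, HasDerivAt (fun s => E s i j) ((shapeMatrix n ε kt * E σ) i j) σ)
    (hF : ∀ σ ∈ I, ∀ i j, HasDerivAt (fun s => F s i j) ((shapeMatrix n ε kt * F σ) i j) σ)
    (hEG : ∀ σ ∈ I, E σ * (minkMatrix n * (E σ)ᵀ) = signMatrix n ε)
    (hFG : ∀ σ ∈ I, (F σ)ᵀ * (signMatrix n ε * F σ) = minkMatrix n) :
    ∃ A : Matrix (Fin n) (Fin n) ℝ, IsPseudoOrthogonal A ∧ ∀ σ ∈ I, A * (E σ)ᵀ = (F σ)ᵀ := by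
  set T := signMatrix n ε with hTdef
  set J := minkMatrix n with hJdef
  set N := shapeMatrix n ε kt with hN
  have hJ : J * J = 1 := minkMatrix_mul_self n
  have hTt : Tᵀ = T := diagonal_transpose _
  have hJt : Jᵀ = J := diagonal_transpose _
  -- By skew-adjointness the two terms of the derivative of `Fᵀ T E` cancel.
  have hderiv : ∀ σ ∈ I, ∀ i j, HasDerivAt (fun s => ((F s)ᵀ * (T * E s)) i j) 0 σ := by
    intro σ hσ i j
    have h1 := hasDerivAt_matrix_mul_apply (A := fun _ => T) (A' := 0) (t := σ)
      (fun i j => hasDerivAt_const σ (T i j)) (hE σ hσ)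
    have h2 := hasDerivAt_matrix_mul_apply (A := fun s => (F s)ᵀ) (A' := (N * F σ)ᵀ)
      (fun i j => hF σ hσ j i) h1 i j
    refine h2.congr_deriv ?_
    have : (N * F σ)ᵀ * (T * E σ) + (F σ)ᵀ * (0 * E σ + T * (N * E σ)) = 0 := by
      rw [transpose_mul, Matrix.zero_mul, zero_add, Matrix.mul_assoc, ← Matrix.mul_assoc Nᵀ,
        shapeMatrix_transpose_mul_signMatrix, Matrix.neg_mul, Matrix.mul_neg, Matrix.mul_assoc,
        neg_add_cancel]
    exact congrFun (congrFun this i) j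
  obtain ⟨τ, hτ⟩ := hne
  have hconst : ∀ σ ∈ I, (F σ)ᵀ * (T * E σ) = (F τ)ᵀ * (T * E τ) := by
    intro σ hσ
    ext i j
    exact hI.is_const_of_deriv_eq_zero hI'
      (fun s hs => (hderiv s hs i j).differentiableAt.differentiableWithinAt)
      (fun s hs => (hderiv s hs i j).deriv) hσ hτ
  have hEG' := (gram_rows_iff_columns hJ hT).1 (hEG τ hτ)
  have hFG' := (gram_rows_iff_columns hJ hT).2 (hFG τ hτ)
  -- The choice is forced by `E J Eᵀ = T` and `T² = 1`, which give `(Fᵀ T E J) Eᵀ = Fᵀ`.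
  refine ⟨(F τ)ᵀ * (T * E τ) * J, ?_, fun σ hσ => ?_⟩
  · rw [IsPseudoOrthogonal, ← hJdef]
    simp only [transpose_mul, transpose_transpose, hTt, hJt]
    calc J * ((E τ)ᵀ * T * F τ) * J * ((F τ)ᵀ * (T * E τ) * J)
        = J * ((E τ)ᵀ * (T * ((F τ * (J * (F τ)ᵀ)) * (T * E τ)))) * J := by
          simp only [Matrix.mul_assoc]
      _ = J * ((E τ)ᵀ * (T * T * (T * E τ))) * J := by
          rw [hFG', Matrix.mul_assoc T T]
      _ = J := by rw [hT, Matrix.one_mul, hEG', hJ, Matrix.one_mul]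
  · rw [← hconst σ hσ]
    calc (F σ)ᵀ * (T * E σ) * J * (E σ)ᵀ = (F σ)ᵀ * (T * (E σ * (J * (E σ)ᵀ))) := by
          simp only [Matrix.mul_assoc]
      _ = (F σ)ᵀ := by rw [hEG σ hσ, hT, Matrix.mul_one]

/-- The frame computed from a curve is the frame satisfying the frame equations. -/
theorem frameOf_eq {W : ℕ → ℝ → Fin n → ℝ} {c : ℝ → Fin n → ℝ}
    (hε : ∀ i ∈ Set.Icc 1 n, ε i ≠ 0) (hc : ∀ i ∈ Set.Icc 1 (n - 1), curvRatio kt i ≠ 0)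
    (h1 : ∀ σ, W 1 σ = Real.exp (-(kt 1 * σ)) • deriv c σ)
    (hW : ∀ (i : Fin n) (σ : ℝ), HasDerivAt (W (i + 1))
      (∑ j : Fin n, shapeMatrix n ε kt i j • W (j + 1) σ) σ) :
    ∀ i ∈ Set.Icc 1 n, frameOf ε kt c i = W i := by
  intro i
  induction i using Nat.strong_induction_on with
  | _ i ih =>
    intro hi
    match i, ih, hi with
    | 0, _, hi => exact absurd hi.1 (by norm_num)
    | 1, _, _ => ext1 σ; rw [h1]; rfl
    | m + 2, ih, hi =>
      have hm := hi.2
      have hne : ε (m + 2) * curvRatio kt (m + 1) ≠ 0 :=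
        mul_ne_zero (hε _ hi) (hc _ ⟨by omega, by omega⟩)
      ext1 σ
      have hd := (hW ⟨m, by omega⟩ σ).deriv
      rw [shapeMatrix_sum_smul ε kt ⟨m, by omega⟩ fun i => W i σ] at hd
      simp only [show m + 1 < n by omega, if_true] at hd
      rw [frameOf, ih (m + 1) (by omega) ⟨by omega, by omega⟩]
      beta_reduce
      rw [hd, inv_smul_eq_iff₀ hne]
      -- For `m = 0` the dummy vector `frameOf ε kt c 0 = 0` replaces the omitted term of the first
      -- frame equation.
      rcases Nat.eq_zero_or_pos m with rfl | hm0
      · simp [frameOf]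
      · rw [ih m (by omega) ⟨by omega, by omega⟩, if_pos (by omega), neg_smul,
          add_neg_cancel_left]

end Congruence

/-! ### Frenet curves in a spherical arc-length parameter. -/

theorem minkNorm_smul {n : ℕ} (r : ℝ) (x : Fin n → ℝ) : minkNorm (r • x) = |r| * minkNorm x := by
  rw [minkNorm, minkNorm, mink, mink, mulVec_smul, smul_dotProduct, dotProduct_smul, smul_eq_mul,
    smul_eq_mul, ← mul_assoc, abs_mul, abs_mul, Real.sqrt_mul (by positivity),
    Real.sqrt_mul_self (abs_nonneg r)]

/-- The matrix with rows `e 1, …, e n`. -/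
def frameMatrix {n : ℕ} (e : ℕ → ℝ → Fin n → ℝ) (σ : ℝ) : Matrix (Fin n) (Fin n) ℝ :=
  Matrix.of fun i j => e (i + 1) σ j

/-- The rows of a moving matrix, indexed from `1` and extended by zero. -/
def frameRow {n : ℕ} (F : ℝ → Matrix (Fin n) (Fin n) ℝ) (i : ℕ) (σ : ℝ) : Fin n → ℝ :=
  if h : i - 1 < n then F σ ⟨i - 1, h⟩ else 0

theorem frameRow_succ {n : ℕ} (F : ℝ → Matrix (Fin n) (Fin n) ℝ) (i : Fin n) (σ : ℝ) :
    frameRow F (i + 1) σ = F σ i := by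
  simp [frameRow]

theorem exists_eq_succ {n i : ℕ} (hi : i ∈ Set.Icc 1 n) : ∃ j : Fin n, i = j + 1 := by
  obtain ⟨h1, h2⟩ := hi
  exact ⟨⟨i - 1, by omega⟩, by simp; omega⟩

theorem curvRatio_ne_zero {n : ℕ} {kt : ℕ → ℝ} (h : ∀ i ∈ Set.Icc 1 n, kt i ≠ 0) :
    ∀ i ∈ Set.Icc 1 n, curvRatio kt i ≠ 0 := by
  intro i hi
  rw [curvRatio]
  split_ifs
  · exact one_ne_zero
  · exact h i hi

theorem mul_row {n : ℕ} (A B : Matrix (Fin n) (Fin n) ℝ) (i : Fin n) :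
    (A * B) i = ∑ j, A i j • B j := by
  ext l
  simp [mul_apply, Finset.sum_apply]

namespace IsFrenetCurve

variable {n : ℕ} {I : Set ℝ} {α : ℝ → Fin n → ℝ} {e : ℕ → ℝ → Fin n → ℝ} {ε : ℕ → ℝ}
  {κ : ℕ → ℝ → ℝ}

theorem sign_ne_zero (hα : IsFrenetCurve n I α e ε κ) : ∀ i ∈ Set.Icc 1 n, ε i ≠ 0 := by
  intro i hi
  rcases hα.sign i hi with h | h <;> rw [h] <;> norm_num

theorem signMatrix_mul_self (hα : IsFrenetCurve n I α e ε κ) :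
    signMatrix n ε * signMatrix n ε = 1 := by
  rw [signMatrix, diagonal_mul_diagonal, ← diagonal_one]
  congr 1
  ext i
  rcases hα.sign (i + 1) ⟨by omega, by omega⟩ with h | h <;> rw [h] <;> norm_num

/-- A pseudo-orthonormal frame of Minkowski space has at most one timelike vector. -/
theorem sign_eq_one (hα : IsFrenetCurve n I α e ε κ) (hne : I.Nonempty) {p : ℕ}
    (hp : p ∈ Set.Icc 1 n) (hεp : ε p = -1) : ∀ i ∈ Set.Icc 1 n, i ≠ p → ε i = 1 := by
  intro i hi hip
  refine (hα.sign i hi).resolve_right fun hεi => ?_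
  obtain ⟨t, ht⟩ := hne
  have hn : 0 < n := lt_of_lt_of_le (by norm_num) (hp.1.trans hp.2)
  have hd : ∀ j : Fin n, j ≠ ⟨0, hn⟩ →
      (fun i : Fin n => if (i : ℕ) = 0 then (-1 : ℝ) else 1) j = 1 := by
    intro j hj
    exact if_neg fun h => hj (Fin.ext h)
  have h1 : mink (e p t) (e p t) < 0 := by
    rw [hα.orthonormal t ht p hp p hp, if_pos rfl, hεp]; norm_num
  have h2 : mink (e i t) (e i t) < 0 := by
    rw [hα.orthonormal t ht i hi i hi, if_pos rfl, hεi]; norm_num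
  refine diagonal_form_ne_zero_of_neg hd h2 h1 ?_
  have := hα.orthonormal t ht i hi p hp
  rwa [if_neg hip] at this

theorem gram_frameMatrix (hα : IsFrenetCurve n I α e ε κ) {σ : ℝ} (hσ : σ ∈ I) :
    frameMatrix e σ * (minkMatrix n * (frameMatrix e σ)ᵀ) = signMatrix n ε := by
  ext i j
  have h := hα.orthonormal σ hσ (i + 1) ⟨by omega, by omega⟩ (j + 1) ⟨by omega, by omega⟩
  rw [signMatrix, diagonal_apply]
  refine Eq.trans h ?_
  by_cases hij : i = j
  · rw [if_pos hij, if_pos (by rw [hij])]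
  · rw [if_neg hij, if_neg fun h => hij (Fin.ext (by omega))]

/-- In a spherical arc length parameter, the speed is the radius of curvature. -/
theorem minkNorm_deriv_mul (hα : IsFrenetCurve n I α e ε κ) (hn : 2 ≤ n)
    (hs : IsSphericalArcLength I e) {σ : ℝ} (hσ : σ ∈ I) :
    minkNorm (deriv α σ) * κ 1 σ = 1 := by
  have h := hs σ hσ
  have h2 : (2 : ℕ) ∈ Set.Icc 1 n := ⟨by norm_num, hn⟩
  -- The first Frenet equation reads `e₁' = ‖α'‖ ε₂ κ₁ e₂`, and its norm is `1`.
  rw [(hα.frenet σ hσ 1 ⟨le_rfl, by omega⟩).deriv, if_neg (lt_irrefl 1), zero_add,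
    if_pos (by omega), minkNorm_smul, minkNorm_smul] at h
  have he : minkNorm (e 2 σ) = 1 := by
    rw [minkNorm, hα.orthonormal σ hσ 2 h2 2 h2, if_pos rfl]
    rcases hα.sign 2 h2 with h | h <;> simp [h]
  have hε : |ε (1 + 1)| = 1 := by
    rcases hα.sign 2 h2 with h | h <;> simp [h]
  rw [he, abs_mul, hε, abs_of_nonneg (show 0 ≤ minkNorm (deriv α σ) from Real.sqrt_nonneg _),
    abs_of_pos (hα.curvature_one_pos σ hσ), one_mul, mul_one] at h
  exact h

/-- The frame equations of a self-similar curve in a spherical arc length parameter. -/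
theorem hasDerivAt_frame (hα : IsFrenetCurve n I α e ε κ) (hn : 2 ≤ n)
    (hs : IsSphericalArcLength I e) {kt : ℕ → ℝ}
    (hkt : ∀ i ∈ Set.Icc 1 (n - 1), ∀ σ ∈ I, pShapeCurvature κ i σ = kt i) {σ : ℝ} (hσ : σ ∈ I)
    (i : Fin n) :
    HasDerivAt (e (i + 1)) (∑ j : Fin n, shapeMatrix n ε kt i j • e (j + 1) σ) σ := by
  have hv := hα.minkNorm_deriv_mul hn hs hσ
  have hκ0 := (hα.curvature_one_pos σ hσ).ne'
  have hratio : ∀ j ∈ Set.Icc 1 (n - 1),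
      minkNorm (deriv α σ) * κ j σ = curvRatio kt j := by
    intro j hj
    rw [curvRatio]
    split_ifs with h1
    · rw [h1, hv]
    · rw [← hkt j hj σ hσ, pShapeCurvature, if_neg h1, eq_div_iff hκ0]
      linear_combination κ j σ * hv
  refine (hα.frenet σ hσ (i + 1) ⟨by omega, by omega⟩).congr_deriv ?_
  rw [shapeMatrix_sum_smul ε kt i fun j => e j σ, smul_add]
  congr 1
  · split_ifs with h
    · rw [← hratio i ⟨by omega, by omega⟩, Nat.add_sub_cancel, smul_smul]
      congr 1; ring
    · rw [smul_zero]
  · split_ifs with h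
    · rw [← hratio (i + 1) ⟨by omega, by omega⟩, smul_smul]
      congr 1; ring
    · rw [smul_zero]

/-- The curvature of a self-similar curve is an exponential function. -/
theorem exists_curvature_eq (hα : IsFrenetCurve n I α e ε κ) (hI : IsOpen I)
    (hI' : IsPreconnected I) (hne : I.Nonempty) {r : ℝ} (hr : r ≠ 0)
    (h : ∀ σ ∈ I, pShapeCurvature κ 1 σ = r) :
    ∃ c : ℝ, 0 < c ∧ ∀ σ ∈ I, κ 1 σ * Real.exp (r * σ) = c := by
  have hderiv : ∀ σ ∈ I, HasDerivAt (fun s => κ 1 s * Real.exp (r * s)) 0 σ := by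
    intro σ hσ
    have h1 := h σ hσ
    have hκ := hα.curvature_one_pos σ hσ
    have hd0 : deriv (κ 1) σ = -(r * κ 1 σ) := by
      rw [pShapeCurvature, if_pos rfl] at h1
      field_simp at h1
      linarith
    -- Differentiability of `κ 1` follows from `r ≠ 0`: `deriv` takes the value `0` at points of
    -- non-differentiability, and here it is nonzero.
    have hd : DifferentiableAt ℝ (κ 1) σ := differentiableAt_of_deriv_ne_zero (by
      rw [hd0]; exact neg_ne_zero.2 (mul_ne_zero hr hκ.ne'))
    refine (hd.hasDerivAt.mul ((hasDerivAt_id σ).const_mul r).exp).congr_deriv ?_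
    rw [hd0]; simp; ring
  obtain ⟨τ, hτ⟩ := hne
  refine ⟨_, mul_pos (hα.curvature_one_pos τ hτ) (Real.exp_pos (r * τ)), fun σ hσ => ?_⟩
  exact hI.is_const_of_deriv_eq_zero hI'
    (fun s hs => (hderiv s hs).differentiableAt.differentiableWithinAt)
    (fun s hs => (hderiv s hs).deriv) hσ hτ

end IsFrenetCurve

/-! ### From the model frame to the similarity, and the two causal cases. -/

/-- A self-similar curve is similar to any curve whose frame satisfies the same equations. -/
theorem similar_of_modelFrame {k : ℕ} (hk : 1 ≤ k) {I : Set ℝ} (hI : IsOpen I)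
    (hI' : I.OrdConnected) (hne : I.Nonempty) {α : ℝ → Fin (2 * k) → ℝ}
    {e : ℕ → ℝ → Fin (2 * k) → ℝ} {ε : ℕ → ℝ} {κ : ℕ → ℝ → ℝ}
    (hα : IsFrenetCurve (2 * k) I α e ε κ) (hs : IsSphericalArcLength I e) {kt : ℕ → ℝ}
    (hkt0 : ∀ i ∈ Set.Icc 1 (2 * k - 1), kt i ≠ 0)
    (hkt : ∀ i ∈ Set.Icc 1 (2 * k - 1), ∀ σ ∈ I, pShapeCurvature κ i σ = kt i)
    {F : ℝ → Matrix (Fin (2 * k)) (Fin (2 * k)) ℝ}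
    (hF : ∀ σ i j, HasDerivAt (fun s => F s i j) ((shapeMatrix (2 * k) ε kt * F σ) i j) σ)
    (hFG : ∀ σ, (F σ)ᵀ * (signMatrix (2 * k) ε * F σ) = minkMatrix (2 * k))
    (hFdet : ∀ σ, 0 < (F σ).det) {f : ℝ → Fin (2 * k) → ℝ}
    (hf : ∀ σ, HasDerivAt f (Real.exp (kt 1 * σ) • F σ ⟨0, by omega⟩) σ) :
    (∃ (c : ℝ) (A : Matrix (Fin (2 * k)) (Fin (2 * k)) ℝ) (b : Fin (2 * k) → ℝ),
      0 < c ∧ IsPseudoOrthogonal A ∧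
      ((∀ σ ∈ I, 0 < (Matrix.of fun i j : Fin (2 * k) => e (i + 1) σ j).det) → A.det = 1) ∧
      (∀ σ ∈ I, c • A.mulVec (α σ) + b = f σ) ∧
      (∀ σ ∈ I, ∀ i ∈ Set.Icc 1 (2 * k), frameOf ε kt f i σ = A.mulVec (e i σ))) ∧
    ∀ σ, ∀ i ∈ Set.Icc 1 (2 * k), mink (frameOf ε kt f i σ) (frameOf ε kt f i σ) = ε i := by
  have hconn : IsPreconnected I := hI'.isPreconnected
  have hn : 2 ≤ 2 * k := by omega
  have hrow : ∀ (i : Fin (2 * k)) (σ : ℝ), HasDerivAt (frameRow F (i + 1))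
      (∑ j : Fin (2 * k), shapeMatrix (2 * k) ε kt i j • frameRow F (j + 1) σ) σ := by
    intro i σ
    have h1 : frameRow F (i + 1) = fun s => F s i := funext fun s => frameRow_succ F i s
    simp only [frameRow_succ, ← mul_row]
    rw [h1, hasDerivAt_pi]
    exact fun j => hF σ i j
  have hframe := frameOf_eq hα.sign_ne_zero (curvRatio_ne_zero hkt0) (c := f) (W := frameRow F)
    (fun σ => by
      rw [(hf σ).deriv, smul_smul, ← Real.exp_add, neg_add_cancel, Real.exp_zero, one_smul]
      exact frameRow_succ F ⟨0, by omega⟩ σ) hrow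
  have hFrows : ∀ σ, F σ * (minkMatrix (2 * k) * (F σ)ᵀ) = signMatrix (2 * k) ε := fun σ =>
    (gram_rows_iff_columns (minkMatrix_mul_self _) hα.signMatrix_mul_self).2 (hFG σ)
  refine ⟨?_, ?_⟩
  · have hE : ∀ σ ∈ I, ∀ i j, HasDerivAt (fun s => frameMatrix e s i j)
        ((shapeMatrix (2 * k) ε kt * frameMatrix e σ) i j) σ := by
      intro σ hσ i j
      have := hasDerivAt_pi.1 (hα.hasDerivAt_frame hn hs hkt hσ i) j
      refine this.congr_deriv ?_
      simp [mul_apply, frameMatrix]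
    obtain ⟨A, hA, hAE⟩ := exists_isPseudoOrthogonal hI hconn hne hα.signMatrix_mul_self hE
      (fun σ _ => hF σ) (fun σ hσ => hα.gram_frameMatrix hσ) (fun σ _ => hFG σ)
    have hAe : ∀ σ ∈ I, ∀ i : Fin (2 * k), A *ᵥ e (i + 1) σ = F σ i := by
      intro σ hσ i
      ext j
      exact congrFun (congrFun (hAE σ hσ) j) i
    obtain ⟨c, hc, hcκ⟩ := hα.exists_curvature_eq hI hconn hne (hkt0 1 ⟨le_rfl, by omega⟩)
      (hkt 1 ⟨le_rfl, by omega⟩)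
    -- Since `‖α'‖ κ₁ = 1` and `κ₁ e^{κ̃₁ σ} = c`, the factor `e^{κ̃₁ σ}` equals `c ‖α'‖`, so `f' =
    -- c A α'`.
    have hαd : ∀ σ ∈ I, HasDerivAt (fun s => f s - c • (A *ᵥ α s)) 0 σ := by
      intro σ hσ
      have hv := hα.minkNorm_deriv_mul hn hs hσ
      have hv0 : minkNorm (deriv α σ) ≠ 0 := left_ne_zero_of_mul_eq_one hv
      have hd : DifferentiableAt ℝ α σ :=
        (hα.contDiffOn.contDiffAt (hI.mem_nhds hσ)).differentiableAt (by
          simp only [ne_eq, Nat.cast_eq_zero]; omega)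
      have h1 := hd.hasDerivAt
      have h2 : HasDerivAt (fun s => c • (A *ᵥ α s)) (c • (A *ᵥ deriv α σ)) σ := by
        refine HasDerivAt.const_smul c ?_
        rw [hasDerivAt_pi] at h1 ⊢
        intro i
        simp only [mulVec, dotProduct]
        exact HasDerivAt.fun_sum fun j _ => (h1 j).const_mul (A i j)
      refine ((hf σ).sub h2).congr_deriv ?_
      have h3 := hAe σ hσ ⟨0, by omega⟩
      rw [hα.tangent σ hσ, mulVec_smul, smul_smul, ← h3, sub_eq_zero]
      congr 1
      rw [← hcκ σ hσ]
      linear_combination (-Real.exp (kt 1 * σ)) * hv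
    obtain ⟨b, hb⟩ := hI.exists_is_const_of_deriv_eq_zero hconn
      (fun s hs => (hαd s hs).differentiableAt.differentiableWithinAt)
      (fun s hs => (hαd s hs).deriv)
    refine ⟨c, A, b, hc, hA, fun hpos => ?_, fun σ hσ => ?_, fun σ hσ i hi => ?_⟩
    · obtain ⟨τ, hτ⟩ := hne
      have h1 := congrArg Matrix.det (hAE τ hτ)
      rw [det_mul, det_transpose, det_transpose] at h1
      -- From `A Eᵀ = Fᵀ` with both frames positively oriented; pseudo-orthogonality then leaves
      -- only `det A = 1`.
      have hApos : 0 < A.det :=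
        pos_of_mul_pos_left (h1 ▸ hFdet τ) (hpos τ hτ).le
      have h2 := congrArg Matrix.det hA
      have hJ := congrArg Matrix.det (minkMatrix_mul_self (2 * k))
      rw [det_mul, det_one] at hJ
      rw [det_mul, det_mul, det_transpose] at h2
      have h3 : A.det * A.det = 1 := by
        linear_combination (minkMatrix (2 * k)).det * h2 + (1 - A.det * A.det) * hJ
      rcases mul_self_eq_one_iff.1 h3 with h | h
      · exact h
      · linarith
    · rw [← hb σ hσ]; simp
    · obtain ⟨j, rfl⟩ := exists_eq_succ hi
      rw [hframe _ hi, frameRow_succ, hAe σ hσ]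
  · intro σ i hi
    obtain ⟨j, rfl⟩ := exists_eq_succ hi
    rw [hframe _ hi, frameRow_succ]
    have := congrFun (congrFun (hFrows σ) j) j
    rw [signMatrix, diagonal_apply_eq] at this
    exact this

/-- The adapted basis of a shape matrix with simple spectrum, positively oriented. -/
theorem exists_isAdaptedBasis {k : ℕ} (hk : 1 ≤ k) {ε kt : ℕ → ℝ}
    (hkt0 : ∀ i ∈ Set.Icc 1 (2 * k - 1), kt i ≠ 0) {p : ℕ} (hp : p = 1 ∨ p = 2) (hεp : ε p = -1)
    (hε1 : ∀ i ∈ Set.Icc 1 (2 * k), i ≠ p → ε i = 1)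
    {ν : ℕ → ℝ} (hνinj : Set.InjOn ν (Set.Icc 1 k))
    (hν : ∀ i ∈ Set.Icc 1 k,
      Module.End.HasEigenvalue (Matrix.toLin' (shapeMatrix (2 * k) ε kt ^ 2)) (ν i))
    (hpos : 0 < ν 1) :
    ∃ (lam : ℕ → ℝ) (x : ℕ → Fin (2 * k) → ℝ), IsAdaptedBasis k ε kt ν lam x ∧ 0 < lam 1 ∧
      (∀ i ∈ Set.Icc 1 k, x i ⟨0, by omega⟩ ≠ 0) ∧
      0 < ((columnMatrix k ε kt lam x).submatrix id (parityEquiv k)).det *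
        (-ε 1 * (-1) ^ (k - 1)) := by
  have hε : ∀ i ∈ Set.Icc 1 (2 * k), ε i = 1 ∨ ε i = -1 := by
    intro i hi
    by_cases h : i = p
    · exact Or.inr (h ▸ hεp)
    · exact Or.inl (hε1 i hi h)
  have hε0 : ∀ i ∈ Set.Icc 1 (2 * k), ε i ≠ 0 := by
    intro i hi
    rcases hε i hi with h | h <;> rw [h] <;> norm_num
  obtain ⟨hneg, x, hxp, hxe, hx0, hxg⟩ := exists_orthonormal_eigenvectors hk hε0
    (curvRatio_ne_zero hkt0) hp hεp hε1 hνinj hν hpos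
  have hν0 : ∀ i ∈ Set.Icc 1 k, ν i ≠ 0 := by
    intro i hi
    by_cases h : i = 1
    · rw [h]; exact hpos.ne'
    · exact (hneg i ⟨by have := hi.1; omega, hi.2⟩).ne
  have hbasis : IsAdaptedBasis k ε kt ν (fun i => Real.sqrt |ν i|) x :=
    { sign_sq := by rcases hε 1 ⟨le_rfl, by omega⟩ with h | h <;> rw [h] <;> norm_num
      parity := hxp
      eigen := hxe
      gram := hxg
      lam_ne := fun i hi => Real.sqrt_ne_zero'.2 (abs_pos.2 (hν0 i hi))
      first := by rw [Real.sq_sqrt (abs_nonneg _), abs_of_pos hpos]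
      later := fun i hi => by rw [Real.sq_sqrt (abs_nonneg _), abs_of_neg (hneg i hi), neg_neg] }
  obtain ⟨lam, h1, h2, h3⟩ := hbasis.exists_det_pos hk
    (Real.sqrt_pos.2 (abs_pos.2 hpos.ne')) (hx0 1 ⟨le_rfl, hk⟩)
  exact ⟨lam, x, h1, h2, hx0, h3⟩

theorem prod_det_pairs {k : ℕ} (hk : 1 ≤ k) {s : ℝ} {R : ℕ → Matrix (Fin 2) (Fin 2) ℝ}
    (h0 : (R 0).det = s) (h : ∀ i < k, i ≠ 0 → (R i).det = -1) :
    ∏ i : Fin k, (R i).det = s * (-1) ^ (k - 1) := by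
  obtain ⟨m, rfl⟩ : ∃ m, k = m + 1 := ⟨k - 1, by omega⟩
  rw [Fin.prod_univ_succ, Fin.val_zero, h0,
    Finset.prod_congr rfl fun i _ => h (Fin.succ i) (Fin.succ i).2 (by simp)]
  simp

theorem mainTheorem4 (k : ℕ) (hk : 1 ≤ k)
    (I : Set ℝ) (hIopen : IsOpen I) (hIconn : I.OrdConnected) (hIne : I.Nonempty)
    (α : ℝ → Fin (2 * k) → ℝ) (e : ℕ → ℝ → Fin (2 * k) → ℝ) (ε : ℕ → ℝ) (κ : ℕ → ℝ → ℝ)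
    (hα : IsFrenetCurve (2 * k) I α e ε κ) (hσ : IsSphericalArcLength I e)
    -- the p-shape curvatures are non-zero constants
    (kt : ℕ → ℝ) (hkt0 : ∀ i ∈ Set.Icc 1 (2 * k - 1), kt i ≠ 0)
    (hkt : ∀ i ∈ Set.Icc 1 (2 * k - 1), ∀ σ ∈ I, pShapeCurvature κ i σ = kt i)
    -- `ν 1, …, ν k` are the different eigenvalues of `M²`, the largest one first
    (ν : ℕ → ℝ) (hνinj : Set.InjOn ν (Set.Icc 1 k))
    (hν : ∀ x : ℝ, Module.End.HasEigenvalue (Matrix.toLin' (shapeMatrix (2 * k) ε kt ^ 2)) x ↔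
      ∃ i ∈ Set.Icc 1 k, ν i = x)
    (hνmax : ∀ i ∈ Set.Icc 1 k, ν i ≤ ν 1)
    -- `b₁` is a non-zero real number
    (hb : kt 1 ^ 2 < ν 1) :
    (ε 1 = -1 →
      ∃ lam a : ℕ → ℝ,
        (0 < lam 1 ∧ ν 1 = lam 1 ^ 2) ∧
        (∀ i ∈ Set.Icc 2 k, lam i ≠ 0 ∧ ν i = -lam i ^ 2) ∧
        (∀ i ∈ Set.Icc 1 k, a i ≠ 0) ∧
        (∃ (c : ℝ) (A : Matrix (Fin (2 * k)) (Fin (2 * k)) ℝ) (b : Fin (2 * k) → ℝ),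
          0 < c ∧ IsPseudoOrthogonal A ∧
          ((∀ σ ∈ I, 0 < (Matrix.of fun i j : Fin (2 * k) => e (i + 1) σ j).det) → A.det = 1) ∧
          (∀ σ ∈ I, c • A.mulVec (α σ) + b = timelikeModel k (kt 1) lam a σ) ∧
          (∀ σ ∈ I, ∀ i ∈ Set.Icc 1 (2 * k),
            frameOf ε kt (timelikeModel k (kt 1) lam a) i σ = A.mulVec (e i σ))) ∧
        (∀ σ : ℝ,
          mink (frameOf ε kt (timelikeModel k (kt 1) lam a) 1 σ)
            (frameOf ε kt (timelikeModel k (kt 1) lam a) 1 σ) = -1 ∧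
          ∀ i ∈ Set.Icc 2 k,
            mink (frameOf ε kt (timelikeModel k (kt 1) lam a) i σ)
              (frameOf ε kt (timelikeModel k (kt 1) lam a) i σ) = 1)) ∧
    (ε 2 = -1 →
      ∃ lam a : ℕ → ℝ,
        (0 < lam 1 ∧ ν 1 = lam 1 ^ 2) ∧
        (∀ i ∈ Set.Icc 2 k, lam i ≠ 0 ∧ ν i = -lam i ^ 2) ∧
        (∀ i ∈ Set.Icc 1 k, a i ≠ 0) ∧
        (∃ (c : ℝ) (A : Matrix (Fin (2 * k)) (Fin (2 * k)) ℝ) (b : Fin (2 * k) → ℝ),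
          0 < c ∧ IsPseudoOrthogonal A ∧
          ((∀ σ ∈ I, 0 < (Matrix.of fun i j : Fin (2 * k) => e (i + 1) σ j).det) → A.det = 1) ∧
          (∀ σ ∈ I, c • A.mulVec (α σ) + b = spacelikeModel k (kt 1) lam a σ) ∧
          (∀ σ ∈ I, ∀ i ∈ Set.Icc 1 (2 * k),
            frameOf ε kt (spacelikeModel k (kt 1) lam a) i σ = A.mulVec (e i σ))) ∧
        (∀ σ : ℝ,
          mink (frameOf ε kt (spacelikeModel k (kt 1) lam a) 2 σ)
            (frameOf ε kt (spacelikeModel k (kt 1) lam a) 2 σ) = -1 ∧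
          ∀ i ∈ Set.Icc 1 k, i ≠ 2 →
            mink (frameOf ε kt (spacelikeModel k (kt 1) lam a) i σ)
              (frameOf ε kt (spacelikeModel k (kt 1) lam a) i σ) = 1)) := by
  have hνe : ∀ i ∈ Set.Icc 1 k,
      Module.End.HasEigenvalue (Matrix.toLin' (shapeMatrix (2 * k) ε kt ^ 2)) (ν i) :=
    fun i hi => (hν _).2 ⟨i, hi, rfl⟩
  have hpos : 0 < ν 1 := lt_of_le_of_lt (sq_nonneg _) hb
  have hsucc : ∀ i < k, i + 1 ∈ Set.Icc 1 k := fun i hi => ⟨by omega, by omega⟩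
  refine ⟨fun hε => ?_, fun hε => ?_⟩
  · have hε1 := hα.sign_eq_one hIne (p := 1) ⟨le_rfl, by omega⟩ hε
    obtain ⟨lam, x, hx, hl, hx0, hdet⟩ :=
      exists_isAdaptedBasis hk hkt0 (Or.inl rfl) hε hε1 hνinj hνe hpos
    have hb' : kt 1 ^ 2 < lam 1 ^ 2 := hx.first ▸ hb
    have hR : ∀ σ, ∀ i < k, ∀ p q, HasDerivAt (fun s => timelikePair (kt 1) lam i s p q)
        ((pairGenerator ν lam i * timelikePair (kt 1) lam i σ) p q) σ := by
      intro σ i hi p q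
      by_cases h0 : i = 0
      · subst h0
        exact hasDerivAt_timelikePair_zero hx.first hl.ne' σ p q
      · simp only [timelikePair, h0, if_false]
        exact hasDerivAt_circularPair _ (hx.lam_ne _ (hsucc i hi))
          (hx.later _ ⟨by omega, by omega⟩) σ p q
    have hG : ∀ σ, ∀ i < k, (timelikePair (kt 1) lam i σ)ᵀ *
        (pairGram (ε 1) i * timelikePair (kt 1) lam i σ) = pairGram (-1) i := by
      intro σ i hi
      by_cases h0 : i = 0
      · subst h0
        rw [hε]
        exact gram_timelikePair_zero hb' σ
      · simp only [timelikePair, pairGram, h0, if_false, Matrix.one_mul]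
        exact gram_circularPair (by omega) (hx.lam_ne _ (hsucc i hi)) σ
    have hdetF : ∀ σ, 0 < (modelFrame k ε kt lam x (timelikePair (kt 1) lam) σ).det := by
      intro σ
      rw [det_modelFrame, prod_det_pairs hk (R := fun i => timelikePair (kt 1) lam i σ)
        (det_timelikePair_zero hb' σ)]
      · simpa [hε] using hdet
      · intro i hi h0
        simp only [timelikePair, h0, if_false]
        exact det_circularPair (by omega) (hx.lam_ne _ (hsucc i hi)) σ
    obtain ⟨hsim, hquad⟩ := similar_of_modelFrame hk hIopen hIconn hIne hα hσ hkt0 hkt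
      (fun σ => hasDerivAt_modelFrame hx (hR σ)) (fun σ => gram_modelFrame hx (hG σ)) hdetF
      (hasDerivAt_timelikeModel hk hx (kt 1))
    refine ⟨lam, fun i => x i ⟨0, by omega⟩, ⟨hl, hx.first⟩,
      fun i hi => ⟨hx.lam_ne i ⟨by have := hi.1; omega, hi.2⟩, hx.later i hi⟩, hx0, hsim,
      fun σ => ⟨?_, fun i hi => ?_⟩⟩
    · rw [hquad σ 1 ⟨le_rfl, by omega⟩, hε]
    · have hi1 := hi.1
      have hi2 := hi.2
      rw [hquad σ i ⟨by omega, by omega⟩, hε1 i ⟨by omega, by omega⟩ (by omega)]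
  · have hε2 := hα.sign_eq_one hIne (p := 2) ⟨by norm_num, by omega⟩ hε
    have hε1 : ε 1 = 1 := hε2 1 ⟨le_rfl, by omega⟩ (by norm_num)
    obtain ⟨lam, x, hx, hl, hx0, hdet⟩ :=
      exists_isAdaptedBasis hk hkt0 (Or.inr rfl) hε hε2 hνinj hνe hpos
    have hb' : kt 1 ^ 2 < lam 1 ^ 2 := hx.first ▸ hb
    have hR : ∀ σ, ∀ i < k, ∀ p q, HasDerivAt (fun s => spacelikePair (kt 1) lam i s p q)
        ((pairGenerator ν lam i * spacelikePair (kt 1) lam i σ) p q) σ := by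
      intro σ i hi p q
      by_cases h0 : i = 0
      · subst h0
        exact hasDerivAt_spacelikePair_zero hx.first hl.ne' σ p q
      · simp only [spacelikePair, h0, if_false]
        exact hasDerivAt_circularPair _ (hx.lam_ne _ (hsucc i hi))
          (hx.later _ ⟨by omega, by omega⟩) σ p q
    have hG : ∀ σ, ∀ i < k, (spacelikePair (kt 1) lam i σ)ᵀ *
        (pairGram (ε 1) i * spacelikePair (kt 1) lam i σ) = pairGram (-1) i := by
      intro σ i hi
      by_cases h0 : i = 0
      · subst h0
        rw [hε1]
        exact gram_spacelikePair_zero hb' σ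
      · simp only [spacelikePair, pairGram, h0, if_false, Matrix.one_mul]
        exact gram_circularPair (by omega) (hx.lam_ne _ (hsucc i hi)) σ
    have hdetF : ∀ σ, 0 < (modelFrame k ε kt lam x (spacelikePair (kt 1) lam) σ).det := by
      intro σ
      rw [det_modelFrame, prod_det_pairs hk (R := fun i => spacelikePair (kt 1) lam i σ)
        (det_spacelikePair_zero hb' σ)]
      · simpa [hε1] using hdet
      · intro i hi h0
        simp only [spacelikePair, h0, if_false]
        exact det_circularPair (by omega) (hx.lam_ne _ (hsucc i hi)) σ
    obtain ⟨hsim, hquad⟩ := similar_of_modelFrame hk hIopen hIconn hIne hα hσ hkt0 hkt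
      (fun σ => hasDerivAt_modelFrame hx (hR σ)) (fun σ => gram_modelFrame hx (hG σ)) hdetF
      (hasDerivAt_spacelikeModel hk hx (kt 1))
    refine ⟨lam, fun i => x i ⟨0, by omega⟩, ⟨hl, hx.first⟩,
      fun i hi => ⟨hx.lam_ne i ⟨by have := hi.1; omega, hi.2⟩, hx.later i hi⟩, hx0, hsim,
      fun σ => ⟨?_, fun i hi hne => ?_⟩⟩
    · rw [hquad σ 2 ⟨by norm_num, by omega⟩, hε]
    · have hi1 := hi.1
      have hi2 := hi.2
      rw [hquad σ i ⟨by omega, by omega⟩, hε2 i ⟨by omega, by omega⟩ hne]
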